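/- Fix integers $r,h_0\ge 1$ and constants $\gamma>2$, $\delta\in[0,1]$, $K$, $\sigma_f,\sigma_\varepsilon,C_1,c>0$. Let $p=p_k\to\infty$ and $n=n_k\to\infty$. For each $k$ let $$x_t=A f_t+\varepsilon_t=A^s f_t^s+\varepsilon_t\in\mathbb R^p ,\qquad t\in\mathbb Z,$$ where $A^s\in\mathbb R^{p\times r}$ has the largest possible number of zero entries among all $p\times r$ matrices with the same column space as $A$, its columns have the same Euclidean norms as those of $A$, and they are ordered by increasing number of nonzero entries. Let $m$ be the number of nonzero entries of $A^s$. All objects may depend on $k$ (so $A^s$, the processes and the probability space form a triangular array), while $r,h_0$ and the constants above do not. For a process $y_t$ put $\Sigma_y(h)=\frac1{n-h}\sum_{t=1}^{n-h}\mathrm E(y_ty_{t+h}^\top)$, $\hat\Sigma_y(h)=\frac1{n-h}\sum_{t=1}^{n-h}y_ty_{t+h}^\top$, $M=\sum_{h=1}^{h_0}\Sigma_x(h)\Sigma_x(h)^\top$ and $\hat M=\sum_{h=1}^{h_0}\hat\Sigma_x(h)\hat\Sigma_x(h)^\top$. Write $a_k\asymp b_k$ if $a_k/b_k$ converges to a positive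 constant. Assume: (C1) the $\alpha$-mixing coefficients $\alpha(t)=\sup_i\sup\{|P(E\cap F)-P(E)P(F)|: E\in\sigma(f^s_u,u\le i),\ F\in\sigma(f^s_u,u\ge i+t)\}$ satisfy $\sum_{t\ge1}\alpha(t)^{1-2/\gamma}\le K$; (C2) $\mathrm E f^s_{t,i}=0$ and $\mathrm E|f^s_{t,i}|^{2\gamma}<\sigma_f^{2\gamma}$ for $1\le t\le n$, $1\le i\le r$; (C3) the vectors $\varepsilon_t$ are square integrable for $1\le t\le n$, independent over $t$, and, conditionally on the factor process $\mathcal F=\sigma(f^s_u,u\in\mathbb Z)$, for $1\le s\neq t\le n$: $\mathrm E(\varepsilon_t\mid\mathcal F)=0$, $\mathrm E(\varepsilon_s\varepsilon_t^\top\mid\mathcal F)=0$, and each entry of $\mathrm E(\varepsilon_t\varepsilon_t^\top\mid\mathcal F)$ is at most $\sigma_\varepsilon^2$ in absolute value, almost surely (for instance, the noise is independent of the factors, centred and serially independent, with covariances bounded by $\sigma_\varepsilon^2$); (C4) $\|A^s\|_2^2\asymp\|A^s\|_{\min}^2\asymp m^{1-\delta}$, where $\|\cdot\|_2$ is the largest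 and $\|\cdot\|_{\min}$ the smallest nonzero singular value, and all entries of $A^s$ are at most $C_1$ in absolute value; (C5) for all large $k$, $M$ has exactly $r$ distinct nonzero eigenvalues, and the smallest eigenvalue of $\sum_{h=1}^{h_0}\Sigma_{f^s}(h)\Sigma_{f^s}(h)^\top$ is at least $c$. Assume further that $m^{\delta-1}pn^{-1/2}=o(1)$. Let $Q$ be $A^s$ with each column divided by the norm of its component orthogonal to the preceding columns, let $S$ be obtained from $Q$ by the Gram–Schmidt process, and let $\hat S$ be any maximizer of $\operatorname{tr}(T^\top\hat MT)$ over $p\times r$ matrices $T$ with $T^\top T=I_r$ (for example, the matrix of orthonormal eigenvectors of $\hat M$ for its $r$ largest eigenvalues). Write $\mathcal M(Z)$ for the column space of $Z$ and $\Pi_{\mathcal M(Z)}$ for the orthogonal projection onto it. Then $$\bigl\|\Pi_{\mathcal M(\hat S)}-\Pi_{\mathcal M(S)}\bigr\|_2=O_p\bigl(m^{\delta-1}pn^{-1/2}\bigr),$$ and likewise $\mathcal D(\mathcal M(\hat S),\mathcal M(S))=\bigl(1-\tfrac1r\operatorname{tr}(\Pi_{\mathcal M(\hat S)}\Pi_{\mathcal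 M(S)})\bigr)^{1/2}=O_p\bigl(m^{\delta-1}pn^{-1/2}\bigr)$. -/

import Mathlib

open MeasureTheory ProbabilityTheory Filter Topology

noncomputable section

namespace FactorModel

/-! ### Matrices and subspaces -/

/-- The `j`-th column of `Z`, as a vector of Euclidean space. -/
def col {p r : ℕ} (Z : Matrix (Fin p) (Fin r) ℝ) (j : Fin r) : EuclideanSpace ℝ (Fin p) :=
  WithLp.toLp 2 (fun i => Z i j)

/-- `ℳ(Z)`, the space spanned by the columns of `Z`. -/
def colSpace {p r : ℕ} (Z : Matrix (Fin p) (Fin r) ℝ) :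
    Submodule ℝ (EuclideanSpace ℝ (Fin p)) :=
  Submodule.span ℝ (Set.range (col Z))

/-- The number of nonzero entries of `Z`. -/
def nnz {p r : ℕ} (Z : Matrix (Fin p) (Fin r) ℝ) : ℕ :=
  {ij : Fin p × Fin r | Z ij.1 ij.2 ≠ 0}.ncard

/-- The number of nonzero entries of the `j`-th column of `Z`. -/
def nnzCol {p r : ℕ} (Z : Matrix (Fin p) (Fin r) ℝ) (j : Fin r) : ℕ :=
  {i : Fin p | Z i j ≠ 0}.ncard

open scoped Matrix.Norms.L2Operator in
/-- The spectral norm `‖Z‖₂`. -/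
def specNorm {p r : ℕ} (Z : Matrix (Fin p) (Fin r) ℝ) : ℝ := ‖Z‖

/-- `‖Z‖_min`, the smallest nonzero singular value of `Z`. -/
def minSing {p r : ℕ} (Z : Matrix (Fin p) (Fin r) ℝ) : ℝ :=
  sInf {s : ℝ | 0 < s ∧
    Module.End.HasEigenvalue (Matrix.toLin' (Matrix.transpose Z * Z)) (s ^ 2)}

/-- The spectral norm of the difference of the orthogonal projections onto two subspaces. -/
def projDist {p : ℕ} (U V : Submodule ℝ (EuclideanSpace ℝ (Fin p))) : ℝ :=
  ‖U.starProjection - V.starProjection‖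

/-- The distance `(1 - tr(H₁H₁ᵀH₂H₂ᵀ)/r)^{1/2}` of two `r`-dimensional subspaces; `HᵢHᵢᵀ` is the
orthogonal projection when the columns of `Hᵢ` form an orthonormal basis. -/
def traceDist {p : ℕ} (r : ℕ) (U V : Submodule ℝ (EuclideanSpace ℝ (Fin p))) : ℝ :=
  Real.sqrt (1 - LinearMap.trace ℝ (EuclideanSpace ℝ (Fin p))
    ((U.starProjection ∘L V.starProjection).toLinearMap) / r)

/-! ### The loading matrices `Aˢ`, `Q`, `S` -/

/-- `As` is a sparsest loading matrix in the loading space of `A`, with the same column norms as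
`A` and with columns ordered by their number of nonzero entries. -/
structure IsSparseLoading {p r : ℕ} (A As : Matrix (Fin p) (Fin r) ℝ) : Prop where
  colSpace_eq : colSpace As = colSpace A
  sparsest : ∀ B : Matrix (Fin p) (Fin r) ℝ, colSpace B = colSpace A → nnz As ≤ nnz B
  norm_col : ∀ i, ‖col As i‖ = ‖col A i‖
  mono : Monotone (nnzCol As)

/-- The standardized loading matrix `Q`: each column of `As` is rescaled so that its component
orthogonal to the preceding columns has norm one. -/
def stdLoading {p r : ℕ} (As : Matrix (Fin p) (Fin r) ℝ) : Matrix (Fin p) (Fin r) ℝ :=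
  Matrix.of fun i j => ‖InnerProductSpace.gramSchmidt ℝ (col As) j‖⁻¹ * As i j

/-- The matrix `S` obtained from `Q` by the Gram–Schmidt process. -/
def orthLoading {p r : ℕ} (As : Matrix (Fin p) (Fin r) ℝ) : Matrix (Fin p) (Fin r) ℝ :=
  Matrix.of fun i j => InnerProductSpace.gramSchmidt ℝ (col (stdLoading As)) j i

/-! ### Population and sample autocovariances, and the estimator -/

section Cov

variable {Ω : Type*} [MeasurableSpace Ω]

/-- `(n-h)⁻¹ ∑_{t=1}^{n-h} E(y_t y_{t+h}ᵀ)`. -/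
def autocov (P : Measure Ω) {d : ℕ} (y : ℤ → Ω → Fin d → ℝ) (n h : ℕ) :
    Matrix (Fin d) (Fin d) ℝ :=
  Matrix.of fun i j =>
    ((n : ℝ) - (h : ℝ))⁻¹ * ∑ t ∈ Finset.Icc 1 (n - h), ∫ ω, y (t : ℤ) ω i * y ((t : ℤ) + h) ω j ∂P

/-- `(n-h)⁻¹ ∑_{t=1}^{n-h} y_t y_{t+h}ᵀ`. -/
def sampleAutocov {d : ℕ} (y : ℤ → Ω → Fin d → ℝ) (n h : ℕ) (ω : Ω) :
    Matrix (Fin d) (Fin d) ℝ :=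
  Matrix.of fun i j =>
    ((n : ℝ) - (h : ℝ))⁻¹ * ∑ t ∈ Finset.Icc 1 (n - h), y (t : ℤ) ω i * y ((t : ℤ) + h) ω j

/-- `∑_{h=1}^{h₀} Σ_y(h) Σ_y(h)ᵀ`. -/
def covM (P : Measure Ω) {d : ℕ} (y : ℤ → Ω → Fin d → ℝ) (n h₀ : ℕ) : Matrix (Fin d) (Fin d) ℝ :=
  ∑ h ∈ Finset.Icc 1 h₀, autocov P y n h * Matrix.transpose (autocov P y n h)

/-- The sample version of `covM`. -/
def sampleM {d : ℕ} (y : ℤ → Ω → Fin d → ℝ) (n h₀ : ℕ) (ω : Ω) : Matrix (Fin d) (Fin d) ℝ :=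
  ∑ h ∈ Finset.Icc 1 h₀, sampleAutocov y n h ω * Matrix.transpose (sampleAutocov y n h ω)

/-- `S` maximizes `tr(TᵀMT)` over all `p × r` matrices `T` with `TᵀT = I`; in particular this holds
if the columns of `S` are orthonormal eigenvectors for the `r` largest eigenvalues of `M`. -/
def IsEigenEstimator {p r : ℕ} (M : Matrix (Fin p) (Fin p) ℝ) (S : Matrix (Fin p) (Fin r) ℝ) :
    Prop :=
  Matrix.transpose S * S = 1 ∧
    ∀ T : Matrix (Fin p) (Fin r) ℝ, Matrix.transpose T * T = 1 →
      Matrix.trace (Matrix.transpose T * M * T) ≤ Matrix.trace (Matrix.transpose S * M * S)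

/-! ### The conditions -/

/-- The σ-field generated by `f_t`, `t ∈ I`. -/
abbrev sigmaField {r : ℕ} (f : ℤ → Ω → Fin r → ℝ) (I : Set ℤ) : MeasurableSpace Ω :=
  ⨆ t ∈ I, MeasurableSpace.comap (f t) inferInstance

/-- The `α`-mixing coefficient of `f` at distance `t`. -/
def alphaCoeff (P : Measure Ω) {r : ℕ} (f : ℤ → Ω → Fin r → ℝ) (t : ℕ) : ℝ :=
  sSup {a : ℝ | ∃ (i : ℤ) (A B : Set Ω),
    MeasurableSet[sigmaField f (Set.Iic i)] A ∧ MeasurableSet[sigmaField f (Set.Ici (i + t))] B ∧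
    a = |P.real (A ∩ B) - P.real A * P.real B|}

/-- `∑_{t ≥ 1} α(t)^{1-2/γ}` converges, with sum at most `K`. -/
def CondMixing (P : Measure Ω) {r : ℕ} (f : ℤ → Ω → Fin r → ℝ) (γ K : ℝ) : Prop :=
  Summable (fun t : ℕ => alphaCoeff P f (t + 1) ^ (1 - 2 / γ)) ∧
    ∑' t : ℕ, alphaCoeff P f (t + 1) ^ (1 - 2 / γ) ≤ K

/-- `E|f_{t,i}|^{2γ} < σ_f^{2γ}`, for centred factors. -/
def CondMoment (P : Measure Ω) {r : ℕ} (f : ℤ → Ω → Fin r → ℝ) (n : ℕ) (γ σf : ℝ) : Prop :=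
  ∀ t ∈ Set.Icc (1 : ℤ) n, ∀ i,
    ∫ ω, f t ω i ∂P = 0 ∧
    Integrable (fun ω => |f t ω i| ^ (2 * γ)) P ∧ ∫ ω, |f t ω i| ^ (2 * γ) ∂P < σf ^ (2 * γ)

/-- The noise is serially independent and, given the factor process, it is centred (hence
uncorrelated with the factors, also given any σ-field of past factors), serially uncorrelated, and
has covariances bounded by `σε²`. This holds in particular if the noise process has mean zero,
covariances bounded by `σε²`, is serially independent, and is independent of the factor process. -/
structure CondNoise (P : Measure Ω) {p r : ℕ} (f : ℤ → Ω → Fin r → ℝ) (ε : ℤ → Ω → Fin p → ℝ)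
    (n : ℕ) (σε : ℝ) : Prop where
  indep : iIndepFun (fun t : ℤ => ε t) P
  memLp : ∀ t ∈ Set.Icc (1 : ℤ) n, ∀ i, MemLp (fun ω => ε t ω i) 2 P
  centred : ∀ t ∈ Set.Icc (1 : ℤ) n, ∀ i,
    P[fun ω => ε t ω i | sigmaField f Set.univ] =ᵐ[P] 0
  uncorr : ∀ s ∈ Set.Icc (1 : ℤ) n, ∀ t ∈ Set.Icc (1 : ℤ) n, s ≠ t → ∀ i j,
    P[fun ω => ε s ω i * ε t ω j | sigmaField f Set.univ] =ᵐ[P] 0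
  bounded : ∀ t ∈ Set.Icc (1 : ℤ) n, ∀ i j,
    ∀ᵐ ω ∂P, |(P[fun ω => ε t ω i * ε t ω j | sigmaField f Set.univ]) ω| ≤ σε ^ 2

end Cov

/-- `a ≍ b`: the quotient converges to a positive constant. -/
def AsympEq (a b : ℕ → ℝ) : Prop :=
  ∃ c : ℝ, 0 < c ∧ Tendsto (fun k => a k / b k) atTop (𝓝 c)

/-- Factor strength `δ`, with `m` the number of nonzero loadings, and bounded loadings. -/
structure CondStrength {r : ℕ} (p : ℕ → ℕ) (As : ∀ k, Matrix (Fin (p k)) (Fin r) ℝ)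
    (δ C₁ : ℝ) : Prop where
  specNorm_sq : AsympEq (fun k => specNorm (As k) ^ 2) (fun k => (nnz (As k) : ℝ) ^ (1 - δ))
  minSing_sq : AsympEq (fun k => minSing (As k) ^ 2) (fun k => (nnz (As k) : ℝ) ^ (1 - δ))
  max_le : ∀ k i j, |As k i j| ≤ C₁

/-- `M` has exactly `r` distinct nonzero eigenvalues. -/
def CondEigen {p : ℕ} (r : ℕ) (M : Matrix (Fin p) (Fin p) ℝ) : Prop :=
  {μ : ℝ | μ ≠ 0 ∧ Module.End.HasEigenvalue (Matrix.toLin' M) μ}.ncard = r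

/-- `X_k = O_p(a_k)`. -/
def IsBigOp {Ω : ℕ → Type*} [∀ k, MeasurableSpace (Ω k)] (P : ∀ k, Measure (Ω k))
    (X : ∀ k, Ω k → ℝ) (a : ℕ → ℝ) : Prop :=
  ∀ η : ℝ, 0 < η → ∃ C : ℝ, 0 < C ∧
    ∀ᶠ k in atTop, P k {ω | C * a k < |X k ω|} ≤ ENNReal.ofReal η

/-- The rate `m^{δ-1} p n^{-1/2}`. -/
def rate (m p n : ℕ) (δ : ℝ) : ℝ :=
  (m : ℝ) ^ (δ - 1) * (p : ℝ) * (n : ℝ) ^ (-(1 / 2) : ℝ)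

end FactorModel

end

/-! For lags `h ≥ 1` the noise drops out of the population autocovariance: given the factors it is
centred and uncorrelated over time, so `Σ_x(h) = Aˢ Σ_f(h) Aˢᵀ`. Hence `M` factors through `Aˢ`, and
its `r` distinct nonzero eigenvalues force `Aˢ` to have full column rank. If the columns of `S` form
an orthonormal basis of the loading space, then `M = S N Sᵀ` with `N ≥ c ‖Aˢ‖_min⁴`, a spectral gap
of order `m^{2(1-δ)}` (`exists_factorization_posSemidef`).

Comparing the value of `tr(TᵀM̂T)` at its maximizer with its value at `S` gives a Davis–Kahan type
bound in the Frobenius norm: the projections differ by at most `2‖M̂ - M‖/λ` when `N ≥ λ`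
(`norm_proj_sub_le_of_trace_le`). Both distances in the theorem are dominated by this Frobenius
distance and depend only on column spaces.

If every sample autocovariance is within `τ` of its population version, then `‖M̂ - M‖` is at most a
constant times `m^{1-δ} τ + τ²`. Division by the gap leaves a constant times `τ/m^{1-δ} +
(τ/m^{1-δ})²` (`dist_le_of_deviation_le`).

Finally `τ = O_p(p n^{-1/2})`. After `x = Aˢ f + ε` is expanded, the averages of products of factors
and noise have entries with mean square `O(1/n)`: the factor part by Davydov's covariance inequality
and summable mixing (`abs_cov_le_of_mixing`, `integral_sq_factor_mean_le`), the parts with noise by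
orthogonality of the summands. The entrywise bound `‖Aˢ‖² = O(p)` in the Frobenius norm makes the
total `O(p²/n)`. Markov's inequality concludes, and the quadratic term is absorbed because the rate
is eventually at most one. -/

namespace FactorModel

/-! ### Davydov's covariance inequality, by truncation. -/

section Davydov

variable {Ω : Type*} {m₁ m₂ m₀ : MeasurableSpace Ω} {P : Measure Ω} [IsProbabilityMeasure P]

/-- The covariance of a bounded `m₁`-measurable variable with `Y` is controlled by the covariance
of `Y` with the indicator of a set in `m₁`. -/
theorem exists_abs_cov_le_of_bounded (hm₁ : m₁ ≤ m₀) {X Y : Ω → ℝ} {a : ℝ}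
    (hX : StronglyMeasurable[m₁] X) (hXa : ∀ ω, |X ω| ≤ a) (hY : Integrable Y P) :
    ∃ A, MeasurableSet[m₁] A ∧
      |∫ ω, X ω * Y ω ∂P - (∫ ω, X ω ∂P) * ∫ ω, Y ω ∂P| ≤
        2 * a * (∫ ω in A, Y ω ∂P - P.real A * ∫ ω, Y ω ∂P) := by
  set e := ∫ ω, Y ω ∂P with he
  set Z : Ω → ℝ := fun ω => (P[Y | m₁]) ω - e with hZ
  have hZm : StronglyMeasurable[m₁] Z := stronglyMeasurable_condExp.sub stronglyMeasurable_const
  have hZi : Integrable Z P := integrable_condExp.sub (integrable_const _)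
  have hZ0 : ∫ ω, Z ω ∂P = 0 := by
    rw [hZ, integral_sub integrable_condExp (integrable_const _), integral_condExp hm₁]
    simp [he]
  -- Conditioning on `m₁` replaces `Y` by `Z` up to centring. As `Z` has mean zero, `E|Z|` is twice
  -- its integral over this sign set.
  set A : Set Ω := {ω | 0 ≤ Z ω} with hA
  have hAm : MeasurableSet[m₁] A := measurableSet_le measurable_const hZm.measurable
  refine ⟨A, hAm, ?_⟩
  have hX0 : AEStronglyMeasurable X P := (hX.mono hm₁).aestronglyMeasurable
  have hXb : ∀ᵐ ω ∂P, ‖X ω‖ ≤ a := Eventually.of_forall fun ω => by simpa using hXa ω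
  have hXi : Integrable X P := Integrable.of_bound hX0 a hXb
  have hXY : Integrable (X * Y) P := hY.bdd_mul hX0 hXb
  have h1 : ∫ ω, X ω * Y ω ∂P - (∫ ω, X ω ∂P) * e = ∫ ω, X ω * Z ω ∂P := by
    have h2 : ∫ ω, X ω * Y ω ∂P = ∫ ω, X ω * (P[Y | m₁]) ω ∂P := by
      rw [← integral_condExp hm₁ (f := fun ω => X ω * Y ω)]
      exact integral_congr_ae (condExp_mul_of_stronglyMeasurable_left hX hXY hY)
    have h3 : Integrable (fun ω => X ω * (P[Y | m₁]) ω) P :=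
      integrable_condExp.bdd_mul hX0 hXb
    simp only [hZ, mul_sub]
    rw [h2, integral_sub h3 (hXi.mul_const _), integral_mul_const]
  have h4 : |∫ ω, X ω * Z ω ∂P| ≤ a * ∫ ω, |Z ω| ∂P := by
    rw [← integral_const_mul]
    refine (abs_integral_le_integral_abs).trans ?_
    refine integral_mono_of_nonneg (Eventually.of_forall fun ω => abs_nonneg _)
      (hZi.abs.const_mul _) (Eventually.of_forall fun ω => ?_)
    simp only [abs_mul]
    exact mul_le_mul_of_nonneg_right (hXa ω) (abs_nonneg _)
  have h5 : ∫ ω, |Z ω| ∂P = 2 * ∫ ω in A, Z ω ∂P := by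
    have : (fun ω => |Z ω|) = fun ω => 2 * A.indicator Z ω - Z ω := by
      funext ω
      by_cases h : 0 ≤ Z ω
      · rw [Set.indicator_of_mem (show ω ∈ A from h), abs_of_nonneg h]; ring
      · rw [Set.indicator_of_notMem (show ω ∉ A from h), abs_of_neg (not_le.1 h)]; ring
    rw [this, integral_sub ((hZi.indicator (hm₁ _ hAm)).const_mul _) hZi, hZ0,
      integral_const_mul, integral_indicator (hm₁ _ hAm), sub_zero]
  have h6 : ∫ ω in A, Z ω ∂P = ∫ ω in A, Y ω ∂P - P.real A * e := by
    rw [hZ, integral_sub integrable_condExp.integrableOn (integrable_const _),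
      setIntegral_condExp hm₁ hY hAm]
    simp
  rw [h1]
  refine h4.trans (le_of_eq ?_)
  rw [h5, h6]; ring

/-- Covariance inequality for bounded variables under strong mixing. -/
theorem abs_cov_le_of_bounded (hm₁ : m₁ ≤ m₀) (hm₂ : m₂ ≤ m₀) {α : ℝ}
    (hα : ∀ A B, MeasurableSet[m₁] A → MeasurableSet[m₂] B →
      |P.real (A ∩ B) - P.real A * P.real B| ≤ α)
    {X Y : Ω → ℝ} {a b : ℝ} (ha : 0 ≤ a) (hb : 0 ≤ b)
    (hX : StronglyMeasurable[m₁] X) (hXa : ∀ ω, |X ω| ≤ a)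
    (hY : StronglyMeasurable[m₂] Y) (hYb : ∀ ω, |Y ω| ≤ b) :
    |∫ ω, X ω * Y ω ∂P - (∫ ω, X ω ∂P) * ∫ ω, Y ω ∂P| ≤ 4 * α * (a * b) := by
  have hYi : Integrable Y P := Integrable.of_bound (hY.mono hm₂).aestronglyMeasurable b
    (Eventually.of_forall fun ω => by simpa using hYb ω)
  obtain ⟨A, hA, h1⟩ := exists_abs_cov_le_of_bounded hm₁ hX hXa hYi
  -- The same bound with the roles exchanged: `Y` is now the bounded variable and the indicator of
  -- `A` the integrable one. Only the covariance of two events remains.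
  obtain ⟨B, hB, h2⟩ := exists_abs_cov_le_of_bounded (P := P) (Y := A.indicator 1) hm₂ hY hYb
    ((integrable_const (1 : ℝ)).indicator (hm₁ _ hA))
  have e1 : ∫ ω, Y ω * A.indicator 1 ω ∂P = ∫ ω in A, Y ω ∂P := by
    rw [← integral_indicator (hm₁ _ hA)]
    congr 1; funext ω
    by_cases h : ω ∈ A <;> simp [h]
  have e2 : ∫ ω, A.indicator (1 : Ω → ℝ) ω ∂P = P.real A := integral_indicator_one (hm₁ _ hA)
  have e3 : ∫ ω in B, A.indicator (1 : Ω → ℝ) ω ∂P = P.real (A ∩ B) := by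
    rw [integral_indicator_one (hm₁ _ hA), measureReal_restrict_apply (hm₁ _ hA)]
  rw [e1, e2, e3] at h2
  have h3 := hα A B hA hB
  have h4 : ∫ ω in A, Y ω ∂P - P.real A * ∫ ω, Y ω ∂P ≤ 2 * b * α := by
    refine (le_abs_self _).trans ?_
    rw [mul_comm (P.real A)]
    refine h2.trans (mul_le_mul_of_nonneg_left ?_ (by positivity))
    rw [mul_comm (P.real B)]
    exact (le_abs_self _).trans h3
  refine h1.trans ((mul_le_mul_of_nonneg_left h4 (by positivity)).trans (le_of_eq ?_))
  ring

/-- Tail part of the truncation of a real number at level `a`. -/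
noncomputable def tailPart (a x : ℝ) : ℝ := if |x| ≤ a then 0 else x

theorem measurable_tailPart (a : ℝ) : Measurable (tailPart a) :=
  Measurable.ite (measurableSet_le measurable_norm measurable_const) measurable_const measurable_id

theorem abs_sub_tailPart_le {a : ℝ} (ha : 0 ≤ a) (x : ℝ) : |x - tailPart a x| ≤ a := by
  unfold tailPart; split_ifs with h <;> simp [h, ha]

/-- The tail is nonzero only for `|x| > a`, where the nonpositive power `|x|^(1-γ)` is at most
`a^(1-γ)`. This trades a `γ`-th moment for a first moment. -/
theorem abs_tailPart_le {a γ : ℝ} (ha : 0 < a) (hγ : 1 ≤ γ) (x : ℝ) :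
    |tailPart a x| ≤ a ^ (1 - γ) * |x| ^ γ := by
  unfold tailPart; split_ifs with h
  · simp; positivity
  · have hx : 0 < |x| := ha.trans (not_le.1 h)
    have h1 : |x| ^ (1 - γ) ≤ a ^ (1 - γ) :=
      Real.rpow_le_rpow_of_nonpos ha (not_le.1 h).le (by linarith)
    calc |x| = |x| ^ (1 - γ) * |x| ^ γ := by rw [← Real.rpow_add hx]; simp
      _ ≤ _ := mul_le_mul_of_nonneg_right h1 (by positivity)

theorem sq_tailPart_le {a γ : ℝ} (ha : 0 < a) (hγ : 2 ≤ γ) (x : ℝ) :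
    tailPart a x ^ 2 ≤ a ^ (2 - γ) * |x| ^ γ := by
  unfold tailPart; split_ifs with h
  · simp; positivity
  · have hx : 0 < |x| := ha.trans (not_le.1 h)
    have h1 : |x| ^ (2 - γ) ≤ a ^ (2 - γ) :=
      Real.rpow_le_rpow_of_nonpos ha (not_le.1 h).le (by linarith)
    calc x ^ 2 = |x| ^ (2 - γ) * |x| ^ γ := by
            rw [← Real.rpow_add hx]; simp
      _ ≤ _ := mul_le_mul_of_nonneg_right h1 (by positivity)

/-- Davydov's inequality at the truncation level `a` with `sᵞ = α aᵞ`. -/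
theorem abs_cov_le_of_level (hm₁ : m₁ ≤ m₀) (hm₂ : m₂ ≤ m₀) {α γ a s : ℝ}
    (hα : ∀ A B, MeasurableSet[m₁] A → MeasurableSet[m₂] B →
      |P.real (A ∩ B) - P.real A * P.real B| ≤ α)
    (hα0 : 0 < α) (hα1 : α ≤ 1) (hγ : 2 < γ) (ha : 0 < a) (has : s ^ γ = α * a ^ γ)
    {X Y : Ω → ℝ} (hX : StronglyMeasurable[m₁] X) (hY : StronglyMeasurable[m₂] Y)
    (hXi : Integrable (fun ω => |X ω| ^ γ) P) (hXs : ∫ ω, |X ω| ^ γ ∂P ≤ s ^ γ)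
    (hYi : Integrable (fun ω => |Y ω| ^ γ) P) (hYs : ∫ ω, |Y ω| ^ γ ∂P ≤ s ^ γ) :
    |∫ ω, X ω * Y ω ∂P - (∫ ω, X ω ∂P) * ∫ ω, Y ω ∂P| ≤ 10 * (a ^ 2 * α) := by
  -- The choice of level makes the `γ`-th moment at most `α aᵞ`, so the tails have first moment at
  -- most `a α` and second moment at most `a² α`.
  have key : ∀ {Z : Ω → ℝ}, StronglyMeasurable[m₀] Z → Integrable (fun ω => |Z ω| ^ γ) P →
      ∫ ω, |Z ω| ^ γ ∂P ≤ s ^ γ →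
      MemLp (fun ω => tailPart a (Z ω)) 2 P ∧ ∫ ω, |tailPart a (Z ω)| ∂P ≤ a * α ∧
        ∫ ω, tailPart a (Z ω) ^ 2 ∂P ≤ a ^ 2 * α := by
    intro Z hZ hZi hZs
    have hm : AEStronglyMeasurable (fun ω => tailPart a (Z ω)) P :=
      ((measurable_tailPart a).comp hZ.measurable).aestronglyMeasurable
    have hsq : Integrable (fun ω => tailPart a (Z ω) ^ 2) P :=
      (hZi.const_mul (a ^ (2 - γ))).mono' (hm.pow 2) (Eventually.of_forall fun ω => by
        rw [Real.norm_of_nonneg (sq_nonneg _)]; exact sq_tailPart_le ha hγ.le _)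
    refine ⟨(memLp_two_iff_integrable_sq hm).2 hsq, ?_, ?_⟩
    · calc ∫ ω, |tailPart a (Z ω)| ∂P ≤ ∫ ω, a ^ (1 - γ) * |Z ω| ^ γ ∂P :=
            integral_mono_of_nonneg (Eventually.of_forall fun ω => abs_nonneg _)
              (hZi.const_mul _) (Eventually.of_forall fun ω => abs_tailPart_le ha (by linarith) _)
        _ ≤ a ^ (1 - γ) * (α * a ^ γ) := by
            rw [integral_const_mul, ← has]
            exact mul_le_mul_of_nonneg_left hZs (by positivity)
        _ = (a ^ (1 - γ) * a ^ γ) * α := by ring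
        _ = a * α := by rw [← Real.rpow_add ha]; simp
    · calc ∫ ω, tailPart a (Z ω) ^ 2 ∂P ≤ ∫ ω, a ^ (2 - γ) * |Z ω| ^ γ ∂P :=
            integral_mono_of_nonneg (Eventually.of_forall fun ω => sq_nonneg _)
              (hZi.const_mul _) (Eventually.of_forall fun ω => sq_tailPart_le ha hγ.le _)
        _ ≤ a ^ (2 - γ) * (α * a ^ γ) := by
            rw [integral_const_mul, ← has]
            exact mul_le_mul_of_nonneg_left hZs (by positivity)
        _ = (a ^ (2 - γ) * a ^ γ) * α := by ring
        _ = a ^ 2 * α := by rw [← Real.rpow_add ha]; simp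
  obtain ⟨hX2, hX3, hX4⟩ := key (hX.mono hm₁) hXi hXs
  obtain ⟨hY2, hY3, hY4⟩ := key (hY.mono hm₂) hYi hYs
  set X'' : Ω → ℝ := fun ω => tailPart a (X ω) with hX''
  set Y'' : Ω → ℝ := fun ω => tailPart a (Y ω) with hY''
  set X' : Ω → ℝ := fun ω => X ω - X'' ω with hX'
  set Y' : Ω → ℝ := fun ω => Y ω - Y'' ω with hY'
  have mX' : StronglyMeasurable[m₁] X' := hX.sub
    ((measurable_tailPart a).comp hX.measurable).stronglyMeasurable
  have mY' : StronglyMeasurable[m₂] Y' := hY.sub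
    ((measurable_tailPart a).comp hY.measurable).stronglyMeasurable
  have bX' : ∀ ω, |X' ω| ≤ a := fun ω => abs_sub_tailPart_le ha.le _
  have bY' : ∀ ω, |Y' ω| ≤ a := fun ω => abs_sub_tailPart_le ha.le _
  have LX' : MemLp X' 2 P := MemLp.of_bound (mX'.mono hm₁).aestronglyMeasurable a
    (Eventually.of_forall bX')
  have LY' : MemLp Y' 2 P := MemLp.of_bound (mY'.mono hm₂).aestronglyMeasurable a
    (Eventually.of_forall bY')
  have iX' := LX'.integrable one_le_two
  have iY' := LY'.integrable one_le_two
  have iX'' := hX2.integrable one_le_two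
  have iY'' := hY2.integrable one_le_two
  have e1 : ∫ ω, X ω * Y ω ∂P = ∫ ω, X' ω * Y' ω ∂P + ∫ ω, X' ω * Y'' ω ∂P
      + ∫ ω, X'' ω * Y' ω ∂P + ∫ ω, X'' ω * Y'' ω ∂P := by
    have i1 : Integrable (fun ω => X' ω * Y' ω) P := LX'.integrable_mul LY'
    have i2 : Integrable (fun ω => X' ω * Y'' ω) P := LX'.integrable_mul hY2
    have i3 : Integrable (fun ω => X'' ω * Y' ω) P := hX2.integrable_mul LY'
    have i4 : Integrable (fun ω => X'' ω * Y'' ω) P := hX2.integrable_mul hY2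
    have i12 : Integrable (fun ω => X' ω * Y' ω + X' ω * Y'' ω) P := i1.add i2
    have i123 : Integrable (fun ω => X' ω * Y' ω + X' ω * Y'' ω + X'' ω * Y' ω) P := i12.add i3
    rw [← integral_add i1 i2, ← integral_add i12 i3, ← integral_add i123 i4]
    congr 1; funext ω; simp only [hX', hY']; ring
  have e2 : ∫ ω, X ω ∂P = ∫ ω, X' ω ∂P + ∫ ω, X'' ω ∂P := by
    rw [← integral_add iX' iX'']; congr 1; funext ω; simp only [hX']; ring
  have e3 : ∫ ω, Y ω ∂P = ∫ ω, Y' ω ∂P + ∫ ω, Y'' ω ∂P := by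
    rw [← integral_add iY' iY'']; congr 1; funext ω; simp only [hY']; ring
  have f1 := abs_cov_le_of_bounded hm₁ hm₂ hα ha.le ha.le mX' bX' mY' bY'
  have f2 : |∫ ω, X' ω * Y'' ω ∂P| ≤ a * (a * α) := by
    refine abs_integral_le_integral_abs.trans ?_
    refine (integral_mono_of_nonneg (Eventually.of_forall fun ω => abs_nonneg _)
      (iY''.abs.const_mul a) (Eventually.of_forall fun ω => ?_)).trans ?_
    · simp only [abs_mul]; exact mul_le_mul_of_nonneg_right (bX' ω) (abs_nonneg _)
    · rw [integral_const_mul]; exact mul_le_mul_of_nonneg_left hY3 ha.le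
  have f3 : |∫ ω, X'' ω * Y' ω ∂P| ≤ a * (a * α) := by
    refine abs_integral_le_integral_abs.trans ?_
    refine (integral_mono_of_nonneg (Eventually.of_forall fun ω => abs_nonneg _)
      (iX''.abs.const_mul a) (Eventually.of_forall fun ω => ?_)).trans ?_
    · simp only [abs_mul]; rw [mul_comm]; exact mul_le_mul_of_nonneg_right (bY' ω) (abs_nonneg _)
    · rw [integral_const_mul]; exact mul_le_mul_of_nonneg_left hX3 ha.le
  have f4 : |∫ ω, X'' ω * Y'' ω ∂P| ≤ a ^ 2 * α := by
    refine abs_integral_le_integral_abs.trans ?_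
    refine (integral_mono_of_nonneg (Eventually.of_forall fun ω => abs_nonneg _)
      ((hX2.integrable_sq.add hY2.integrable_sq).const_mul (1 / 2))
      (Eventually.of_forall fun ω => ?_)).trans ?_
    · simp only [abs_mul, Pi.add_apply]
      nlinarith [sq_nonneg (|X'' ω| - |Y'' ω|), sq_abs (X'' ω), sq_abs (Y'' ω)]
    · rw [integral_const_mul, integral_add' hX2.integrable_sq hY2.integrable_sq]
      linarith
  have g1 : |∫ ω, X' ω ∂P| ≤ a := by
    have := norm_integral_le_of_norm_le_const (μ := P) (f := X') (C := a)
      (Eventually.of_forall bX')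
    simpa using this
  have g2 : |∫ ω, Y' ω ∂P| ≤ a := by
    have := norm_integral_le_of_norm_le_const (μ := P) (f := Y') (C := a)
      (Eventually.of_forall bY')
    simpa using this
  have g3 : |∫ ω, X'' ω ∂P| ≤ a * α := abs_integral_le_integral_abs.trans hX3
  have g4 : |∫ ω, Y'' ω ∂P| ≤ a * α := abs_integral_le_integral_abs.trans hY3
  have k1 : |(∫ ω, X' ω ∂P) * ∫ ω, Y'' ω ∂P| ≤ a * (a * α) := by
    rw [abs_mul]; exact mul_le_mul g1 g4 (abs_nonneg _) ha.le
  have k2 : |(∫ ω, X'' ω ∂P) * ∫ ω, Y' ω ∂P| ≤ (a * α) * a := by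
    rw [abs_mul]; exact mul_le_mul g3 g2 (abs_nonneg _) (by positivity)
  have k3 : |(∫ ω, X'' ω ∂P) * ∫ ω, Y'' ω ∂P| ≤ a ^ 2 * α := by
    rw [abs_mul]
    refine (mul_le_mul g3 g4 (abs_nonneg _) (by positivity)).trans ?_
    have : a ^ 2 * α * α ≤ a ^ 2 * α * 1 := mul_le_mul_of_nonneg_left hα1 (by positivity)
    nlinarith
  -- The constant 10 is 4 from the bounded parts, plus one `a² α` for each of the three products and
  -- three products of means that involve a tail.
  rw [e1, e2, e3]
  rw [abs_le] at *
  constructor <;> nlinarith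

/-- **Davydov's covariance inequality**, for two variables with the same moment bound. -/
theorem abs_cov_le_of_mixing (hm₁ : m₁ ≤ m₀) (hm₂ : m₂ ≤ m₀) {α γ s : ℝ}
    (hα : ∀ A B, MeasurableSet[m₁] A → MeasurableSet[m₂] B →
      |P.real (A ∩ B) - P.real A * P.real B| ≤ α)
    (hα1 : α ≤ 1) (hγ : 2 < γ) (hs : 0 < s)
    {X Y : Ω → ℝ} (hX : StronglyMeasurable[m₁] X) (hY : StronglyMeasurable[m₂] Y)
    (hXi : Integrable (fun ω => |X ω| ^ γ) P) (hXs : ∫ ω, |X ω| ^ γ ∂P ≤ s ^ γ)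
    (hYi : Integrable (fun ω => |Y ω| ^ γ) P) (hYs : ∫ ω, |Y ω| ^ γ ∂P ≤ s ^ γ) :
    |∫ ω, X ω * Y ω ∂P - (∫ ω, X ω ∂P) * ∫ ω, Y ω ∂P| ≤ 10 * s ^ 2 * α ^ (1 - 2 / γ) := by
  have hγ0 : 0 < γ := by linarith
  -- The level `s β^(-1/γ)` solves `sᵞ = β aᵞ` but needs `β > 0`; allowing any `β ≥ α` covers `α =
  -- 0` by a limit.
  have hpos : ∀ β, 0 < β → β ≤ 1 → α ≤ β →
      |∫ ω, X ω * Y ω ∂P - (∫ ω, X ω ∂P) * ∫ ω, Y ω ∂P| ≤ 10 * s ^ 2 * β ^ (1 - 2 / γ) := by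
    intro β hβ0 hβ1 hαβ
    have h := abs_cov_le_of_level hm₁ hm₂ (fun A B hA hB => (hα A B hA hB).trans hαβ) hβ0 hβ1 hγ
      (a := s * β ^ (-(1 / γ))) (s := s) (by positivity) ?_ hX hY hXi hXs hYi hYs
    · refine h.trans (le_of_eq ?_)
      have : (β ^ (-(1 / γ))) ^ 2 * β = β ^ (1 - 2 / γ) := by
        rw [← Real.rpow_natCast, ← Real.rpow_mul hβ0.le]
        nth_rw 2 [← Real.rpow_one β]
        rw [← Real.rpow_add hβ0]; congr 1; push_cast; ring
      rw [← this]; ring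
    · rw [Real.mul_rpow hs.le (by positivity), ← Real.rpow_mul hβ0.le]
      have : -(1 / γ) * γ = -1 := by field_simp
      rw [this, Real.rpow_neg_one]; field_simp
  have hα0 : 0 ≤ α := (abs_nonneg _).trans
    (hα ∅ ∅ (@MeasurableSet.empty _ m₁) (@MeasurableSet.empty _ m₂))
  rcases hα0.eq_or_lt with h0 | h0
  · have he : 0 < 1 - 2 / γ := by rw [sub_pos, div_lt_one hγ0]; exact hγ
    have ht : Tendsto (fun β : ℝ => 10 * s ^ 2 * β ^ (1 - 2 / γ)) (𝓝[>] 0)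
        (𝓝 (10 * s ^ 2 * 0 ^ (1 - 2 / γ))) :=
      (((Real.continuous_rpow_const he.le).tendsto 0).mono_left nhdsWithin_le_nhds).const_mul _
    rw [← h0]
    refine ge_of_tendsto ht ?_
    filter_upwards [Ioo_mem_nhdsGT (show (0 : ℝ) < 1 by norm_num)] with β hβ
    exact hpos β hβ.1 hβ.2.le (h0 ▸ hβ.1.le)
  · exact hpos α h0 hα1 le_rfl

end Davydov

end FactorModel

namespace FactorModel

/-! ### Mean squares of averages of factor and noise products. -/

section SecondMoments

variable {Ω : Type*} [MeasurableSpace Ω] {P : Measure Ω}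

/-- Each lag occurs at most once on either side of `s`, whence the factor 2. -/
theorem sum_le_two_mul_sum_range {b : ℕ → ℝ} (hb : ∀ d, 0 ≤ b d) {N s : ℕ}
    (hs : s ∈ Finset.Icc 1 N) {v : ℕ → ℝ}
    (hle : ∀ t ∈ Finset.Icc 1 N, s ≤ t → v t ≤ b (t - s))
    (hge : ∀ t ∈ Finset.Icc 1 N, t ≤ s → v t ≤ b (s - t)) :
    ∑ t ∈ Finset.Icc 1 N, v t ≤ 2 * ∑ d ∈ Finset.range N, b d := by
  rw [Finset.mem_Icc] at hs
  have h1 : ∑ t ∈ (Finset.Icc 1 N).filter (fun t => s ≤ t), v t ≤ ∑ d ∈ Finset.range N, b d := by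
    calc _ ≤ ∑ t ∈ (Finset.Icc 1 N).filter (fun t => s ≤ t), b (t - s) :=
          Finset.sum_le_sum fun t ht => by
            rw [Finset.mem_filter] at ht; exact hle t ht.1 ht.2
      _ = ∑ d ∈ ((Finset.Icc 1 N).filter (fun t => s ≤ t)).image (fun t => t - s), b d := by
          rw [Finset.sum_image]
          intro x hx y hy hxy
          simp only [Finset.coe_filter, Finset.mem_Icc, Set.mem_ofPred_eq] at hx hy hxy
          omega
      _ ≤ _ := by
          refine Finset.sum_le_sum_of_subset_of_nonneg ?_ fun _ _ _ => hb _
          intro d hd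
          simp only [Finset.mem_image, Finset.mem_filter, Finset.mem_Icc] at hd
          obtain ⟨t, ht, rfl⟩ := hd
          rw [Finset.mem_range]; omega
  have h2 : ∑ t ∈ (Finset.Icc 1 N).filter (fun t => ¬ s ≤ t), v t
      ≤ ∑ d ∈ Finset.range N, b d := by
    calc _ ≤ ∑ t ∈ (Finset.Icc 1 N).filter (fun t => ¬ s ≤ t), b (s - t) :=
          Finset.sum_le_sum fun t ht => by
            rw [Finset.mem_filter] at ht; exact hge t ht.1 (by omega)
      _ = ∑ d ∈ ((Finset.Icc 1 N).filter (fun t => ¬ s ≤ t)).image (fun t => s - t), b d := by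
          rw [Finset.sum_image]
          intro x hx y hy hxy
          simp only [Finset.coe_filter, Finset.mem_Icc, Set.mem_ofPred_eq] at hx hy hxy
          omega
      _ ≤ _ := by
          refine Finset.sum_le_sum_of_subset_of_nonneg ?_ fun _ _ _ => hb _
          intro d hd
          simp only [Finset.mem_image, Finset.mem_filter, Finset.mem_Icc] at hd
          obtain ⟨t, ht, rfl⟩ := hd
          rw [Finset.mem_range]; omega
  rw [← Finset.sum_filter_add_sum_filter_not (Finset.Icc 1 N) (fun t => s ≤ t)]
  linarith

/-- The second moment of an average of variables whose correlations decay summably. -/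
theorem integral_sq_mean_le {N : ℕ} {c B : ℝ} (hc : c = N) {Y : ℕ → Ω → ℝ} {b : ℕ → ℝ}
    (hY : ∀ t ∈ Finset.Icc 1 N, MemLp (Y t) 2 P) (hb : ∀ d, 0 ≤ b d)
    (hcov : ∀ s ∈ Finset.Icc 1 N, ∀ t ∈ Finset.Icc 1 N, s ≤ t →
      ∫ ω, Y s ω * Y t ω ∂P ≤ b (t - s))
    (hB : ∑ d ∈ Finset.range N, b d ≤ B) :
    Integrable (fun ω => (c⁻¹ * ∑ t ∈ Finset.Icc 1 N, Y t ω) ^ 2) P ∧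
      ∫ ω, (c⁻¹ * ∑ t ∈ Finset.Icc 1 N, Y t ω) ^ 2 ∂P ≤ 2 * B / c := by
  subst hc
  have hL : MemLp (fun ω => (N : ℝ)⁻¹ * ∑ t ∈ Finset.Icc 1 N, Y t ω) 2 P :=
    (memLp_finsetSum _ hY).const_mul _
  refine ⟨hL.integrable_sq, ?_⟩
  have hint : ∀ s ∈ Finset.Icc 1 N, ∀ t ∈ Finset.Icc 1 N,
      Integrable (fun ω => Y s ω * Y t ω) P := fun s hs t ht => (hY s hs).integrable_mul (hY t ht)
  have h1 : ∫ ω, ((N : ℝ)⁻¹ * ∑ t ∈ Finset.Icc 1 N, Y t ω) ^ 2 ∂P =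
      ((N : ℝ)⁻¹) ^ 2 * ∑ s ∈ Finset.Icc 1 N, ∑ t ∈ Finset.Icc 1 N, ∫ ω, Y s ω * Y t ω ∂P := by
    simp only [mul_pow]
    rw [integral_const_mul]
    congr 1
    simp only [sq, Finset.sum_mul_sum]
    rw [integral_finsetSum _ fun s hs => integrable_finsetSum _ fun t ht => hint s hs t ht]
    exact Finset.sum_congr rfl fun s hs => integral_finsetSum _ fun t ht => hint s hs t ht
  have h2 : ∑ s ∈ Finset.Icc 1 N, ∑ t ∈ Finset.Icc 1 N, ∫ ω, Y s ω * Y t ω ∂P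
      ≤ ∑ s ∈ Finset.Icc 1 N, 2 * B := by
    refine Finset.sum_le_sum fun s hs => ?_
    refine (sum_le_two_mul_sum_range hb hs (fun t ht hst => hcov s hs t ht hst)
      (fun t ht hts => ?_)).trans (by linarith)
    simp only [mul_comm (Y s _)]
    exact hcov t ht s hs hts
  rw [h1]
  refine (mul_le_mul_of_nonneg_left h2 (by positivity)).trans (le_of_eq ?_)
  -- For `N = 0` both sides vanish, since `0⁻¹ = 0`.
  rcases Nat.eq_zero_or_pos N with h | h
  · subst h; simp
  · have : (N : ℝ) ≠ 0 := by positivity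
    simp; field_simp

theorem sum_range_ite_zero_le {B : ℝ} (hB : 0 ≤ B) (N : ℕ) :
    ∑ d ∈ Finset.range N, (if d = 0 then B else 0) ≤ B := by
  rw [Finset.sum_ite_eq' (Finset.range N) 0 fun _ => B]
  split_ifs <;> simp [hB]

/-- Average of pairwise orthogonal variables. -/
theorem integral_sq_mean_le_of_orthogonal {N : ℕ} {c B : ℝ} (hc : c = N) (hB : 0 ≤ B)
    {Y : ℕ → Ω → ℝ} (hY : ∀ t ∈ Finset.Icc 1 N, MemLp (Y t) 2 P ∧ ∫ ω, Y t ω ^ 2 ∂P ≤ B)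
    (horth : ∀ s ∈ Finset.Icc 1 N, ∀ t ∈ Finset.Icc 1 N, s < t → ∫ ω, Y s ω * Y t ω ∂P = 0) :
    Integrable (fun ω => (c⁻¹ * ∑ t ∈ Finset.Icc 1 N, Y t ω) ^ 2) P ∧
      ∫ ω, (c⁻¹ * ∑ t ∈ Finset.Icc 1 N, Y t ω) ^ 2 ∂P ≤ 2 * B / c := by
  refine integral_sq_mean_le hc (b := fun d => if d = 0 then B else 0) (fun t ht => (hY t ht).1)
    (fun d => ?_) (fun s hs t ht hst => ?_) (sum_range_ite_zero_le hB N)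
  · split_ifs <;> simp [hB]
  · rcases hst.eq_or_lt with rfl | hlt
    · simpa [← sq] using (hY s hs).2
    · rw [horth s hs t ht hlt]
      split_ifs <;> simp [hB]

theorem mem_Icc_of_mem {n h t : ℕ} (ht : t ∈ Finset.Icc 1 (n - h)) :
    (t : ℤ) ∈ Set.Icc (1 : ℤ) n ∧ (t : ℤ) + h ∈ Set.Icc (1 : ℤ) n := by
  rw [Finset.mem_Icc] at ht
  simp only [Set.mem_Icc]; omega

theorem sq_le_one_add_rpow {γ : ℝ} (hγ : 2 ≤ γ) (x : ℝ) : x ^ 2 ≤ 1 + |x| ^ γ := by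
  rw [← sq_abs]
  rcases le_total |x| 1 with h | h
  · have : |x| ^ 2 ≤ 1 := pow_le_one₀ (abs_nonneg _) h
    have : 0 ≤ |x| ^ γ := by positivity
    linarith
  · have : |x| ^ (2 : ℝ) ≤ |x| ^ γ := Real.rpow_le_rpow_of_exponent_le h hγ
    rw [Real.rpow_two] at this
    linarith

theorem memLp_two_of_rpow [IsProbabilityMeasure P] {γ : ℝ} (hγ : 2 ≤ γ) {X : Ω → ℝ}
    (hX : Measurable X) (hi : Integrable (fun ω => |X ω| ^ γ) P) :
    MemLp X 2 P ∧ ∫ ω, X ω ^ 2 ∂P ≤ 1 + ∫ ω, |X ω| ^ γ ∂P := by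
  have hd : Integrable (fun ω => 1 + |X ω| ^ γ) P := (integrable_const 1).add hi
  have hsq : Integrable (fun ω => X ω ^ 2) P :=
    hd.mono' (hX.pow_const 2).aestronglyMeasurable (Eventually.of_forall fun ω => by
      rw [Real.norm_of_nonneg (sq_nonneg _)]; exact sq_le_one_add_rpow hγ _)
  refine ⟨(memLp_two_iff_integrable_sq hX.aestronglyMeasurable).2 hsq, ?_⟩
  have := integral_mono hsq hd fun ω => sq_le_one_add_rpow hγ _
  rwa [integral_add (integrable_const 1) hi, integral_const, probReal_univ, one_smul] at this

theorem abs_mul_rpow_le {γ : ℝ} (a b : ℝ) :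
    |a * b| ^ γ ≤ 1 / 2 * (|a| ^ (2 * γ) + |b| ^ (2 * γ)) := by
  rw [abs_mul, Real.mul_rpow (abs_nonneg _) (abs_nonneg _), mul_comm 2 γ,
    Real.rpow_mul (abs_nonneg _), Real.rpow_mul (abs_nonneg _), Real.rpow_two, Real.rpow_two]
  nlinarith [sq_nonneg (|a| ^ γ - |b| ^ γ)]

/-! ### Mixing coefficients -/

theorem sigmaField_le {Ω : Type*} {mΩ : MeasurableSpace Ω} {r : ℕ} {f : ℤ → Ω → Fin r → ℝ}
    (hf : ∀ t, Measurable (f t)) (I : Set ℤ) : sigmaField f I ≤ mΩ :=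
  iSup₂_le fun t _ => (hf t).comap_le

theorem measurable_sigmaField {Ω : Type*} {r : ℕ} (f : ℤ → Ω → Fin r → ℝ) {I : Set ℤ} {t : ℤ} (ht : t ∈ I)
    (i : Fin r) : Measurable[sigmaField f I] (fun ω => f t ω i) := by
  have h : Measurable[sigmaField f I] (f t) :=
    Measurable.mono (comap_measurable (f t)) (le_iSup₂_of_le t ht le_rfl) le_rfl
  exact (measurable_pi_apply i).comp h

theorem abs_measureReal_inter_sub_le_one [IsProbabilityMeasure P] (A B : Set Ω) :
    |P.real (A ∩ B) - P.real A * P.real B| ≤ 1 := by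
  have h1 : P.real (A ∩ B) ≤ 1 := measureReal_le_one
  have h2 : P.real A ≤ 1 := measureReal_le_one
  have h3 : P.real B ≤ 1 := measureReal_le_one
  have h4 : 0 ≤ P.real (A ∩ B) := measureReal_nonneg
  have h5 : 0 ≤ P.real A := measureReal_nonneg
  have h6 : 0 ≤ P.real B := measureReal_nonneg
  rw [abs_le]; constructor <;> nlinarith [mul_nonneg h5 h6, mul_le_one₀ h2 h6 h3]

theorem alphaCoeff_le_one [IsProbabilityMeasure P] {r : ℕ} (f : ℤ → Ω → Fin r → ℝ) (t : ℕ) :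
    alphaCoeff P f t ≤ 1 := by
  refine Real.sSup_le ?_ zero_le_one
  rintro a ⟨i, A, B, -, -, rfl⟩
  exact abs_measureReal_inter_sub_le_one A B

/-- A real supremum dominates its members only if they are bounded above; here the bound is 1. -/
theorem le_alphaCoeff [IsProbabilityMeasure P] {r : ℕ} (f : ℤ → Ω → Fin r → ℝ) (t : ℕ) (i : ℤ)
    {A B : Set Ω} (hA : MeasurableSet[sigmaField f (Set.Iic i)] A)
    (hB : MeasurableSet[sigmaField f (Set.Ici (i + t))] B) :
    |P.real (A ∩ B) - P.real A * P.real B| ≤ alphaCoeff P f t := by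
  refine le_csSup ⟨1, ?_⟩ ⟨i, A, B, hA, hB, rfl⟩
  rintro a ⟨i, A, B, -, -, rfl⟩
  exact abs_measureReal_inter_sub_le_one A B

theorem alphaCoeff_nonneg (P : Measure Ω) {r : ℕ} (f : ℤ → Ω → Fin r → ℝ) (t : ℕ) :
    0 ≤ alphaCoeff P f t := by
  refine Real.sSup_nonneg ?_
  rintro a ⟨i, A, B, -, -, rfl⟩
  exact abs_nonneg _

/-! ### Moments of the factors -/

theorem CondMoment.memLp [IsProbabilityMeasure P] {r n : ℕ} {f : ℤ → Ω → Fin r → ℝ} {γ σf : ℝ}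
    (h : CondMoment P f n γ σf) (hγ : 2 < γ) (hf : ∀ t, Measurable (f t)) {t : ℤ}
    (ht : t ∈ Set.Icc (1 : ℤ) n) (i : Fin r) :
    MemLp (fun ω => f t ω i) 2 P ∧ ∫ ω, f t ω i ^ 2 ∂P ≤ 1 + σf ^ (2 * γ) := by
  obtain ⟨-, h2, h3⟩ := h t ht i
  obtain ⟨h4, h5⟩ := memLp_two_of_rpow (by linarith)
    ((measurable_pi_apply i).comp (hf t)) h2
  exact ⟨h4, h5.trans (by simpa using h3.le)⟩

/-- By the inequality of arithmetic and geometric means, `2γ` moments of the factors give `γ`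
moments of their products, the variables to which Davydov's inequality is applied. -/
theorem CondMoment.mul_rpow {r n : ℕ} {f : ℤ → Ω → Fin r → ℝ} {γ σf : ℝ}
    (h : CondMoment P f n γ σf) (hf : ∀ t, Measurable (f t)) {s t : ℤ}
    (hs : s ∈ Set.Icc (1 : ℤ) n) (ht : t ∈ Set.Icc (1 : ℤ) n) (i j : Fin r) :
    Integrable (fun ω => |f s ω i * f t ω j| ^ γ) P ∧
      ∫ ω, |f s ω i * f t ω j| ^ γ ∂P ≤ σf ^ (2 * γ) := by
  obtain ⟨-, h2, h3⟩ := h s hs i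
  obtain ⟨-, h5, h6⟩ := h t ht j
  have hd := (h2.add h5).const_mul (1 / 2)
  have hm : Measurable fun ω => f s ω i * f t ω j :=
    ((measurable_pi_apply i).comp (hf s)).mul ((measurable_pi_apply j).comp (hf t))
  have hi : Integrable (fun ω => |f s ω i * f t ω j| ^ γ) P :=
    hd.mono' (hm.abs.pow_const γ).aestronglyMeasurable (Eventually.of_forall fun ω => by
      rw [Real.norm_of_nonneg (by positivity)]; exact abs_mul_rpow_le _ _)
  refine ⟨hi, ?_⟩
  have := integral_mono hi hd fun ω => abs_mul_rpow_le _ _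
  rw [integral_const_mul, integral_add' h2 h5] at this
  linarith

/-- Products at times `t, t + h` occupy windows of length `h`. For the `h + 1` gaps `d ≤ h` the
windows may meet and only a variance bound `κ` is available; beyond that the distance between them
is `d - h` and mixing applies. -/
theorem sum_range_decay_le {α : ℕ → ℝ} {e κ C K : ℝ} (hκ : 0 ≤ κ) (hC : 0 ≤ C)
    (hα : ∀ t, 0 ≤ α t) (hs : Summable fun t : ℕ => α (t + 1) ^ e)
    (hK : ∑' t : ℕ, α (t + 1) ^ e ≤ K) (h N : ℕ) :
    ∑ d ∈ Finset.range N, (if d ≤ h then κ else C * α (d - h) ^ e) ≤ (h + 1) * κ + C * K := by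
  have hb : ∀ d, 0 ≤ (if d ≤ h then κ else C * α (d - h) ^ e) := fun d => by
    have := hα (d - h)
    split_ifs <;> positivity
  calc _ ≤ ∑ d ∈ Finset.range (h + 1 + N), (if d ≤ h then κ else C * α (d - h) ^ e) :=
        Finset.sum_le_sum_of_subset_of_nonneg
          (Finset.range_subset_range.2 (by omega)) fun _ _ _ => hb _
    _ = ∑ d ∈ Finset.range (h + 1), κ + ∑ d ∈ Finset.range N, C * α (d + 1) ^ e := by
        rw [Finset.sum_range_add]
        congr 1
        · refine Finset.sum_congr rfl fun d hd => ?_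
          rw [Finset.mem_range] at hd
          rw [if_pos (by omega)]
        · refine Finset.sum_congr rfl fun d hd => ?_
          rw [if_neg (by omega), show h + 1 + d - h = d + 1 by omega]
    _ ≤ _ := by
        rw [← Finset.mul_sum]
        refine add_le_add (by simp) (mul_le_mul_of_nonneg_left ?_ hC)
        exact (hs.sum_le_tsum _ fun d _ => Real.rpow_nonneg (hα _) _).trans hK

/-- The sample autocovariances of the factors deviate from their means by `O(n^{-1/2})` in `L²`. -/
theorem integral_sq_factor_mean_le [IsProbabilityMeasure P] {r n h : ℕ} {f : ℤ → Ω → Fin r → ℝ}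
    {γ K σf : ℝ} (hγ : 2 < γ) (hσf : 0 < σf) (hf : ∀ t, Measurable (f t))
    (hmix : CondMixing P f γ K) (hmom : CondMoment P f n γ σf) (hhn : h ≤ n) (i j : Fin r) :
    Integrable (fun ω => (((n : ℝ) - h)⁻¹ * ∑ t ∈ Finset.Icc 1 (n - h),
        (f (t : ℤ) ω i * f ((t : ℤ) + h) ω j
          - ∫ ω', f (t : ℤ) ω' i * f ((t : ℤ) + h) ω' j ∂P)) ^ 2) P ∧
      ∫ ω, (((n : ℝ) - h)⁻¹ * ∑ t ∈ Finset.Icc 1 (n - h),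
        (f (t : ℤ) ω i * f ((t : ℤ) + h) ω j
          - ∫ ω', f (t : ℤ) ω' i * f ((t : ℤ) + h) ω' j ∂P)) ^ 2 ∂P
        ≤ 2 * ((h + 1) * (1 + σf ^ (2 * γ)) + 10 * (σf ^ 2) ^ 2 * K) / ((n : ℝ) - h) := by
  set X : ℕ → Ω → ℝ := fun t ω => f (t : ℤ) ω i * f ((t : ℤ) + h) ω j with hXdef
  have hXm : ∀ t, Measurable (X t) := fun t =>
    ((measurable_pi_apply i).comp (hf _)).mul ((measurable_pi_apply j).comp (hf _))
  have hXγ : ∀ t ∈ Finset.Icc 1 (n - h), Integrable (fun ω => |X t ω| ^ γ) P ∧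
      ∫ ω, |X t ω| ^ γ ∂P ≤ σf ^ (2 * γ) := fun t ht =>
    hmom.mul_rpow hf (mem_Icc_of_mem ht).1 (mem_Icc_of_mem ht).2 i j
  have hX2 : ∀ t ∈ Finset.Icc 1 (n - h), MemLp (X t) 2 P ∧
      ∫ ω, X t ω ^ 2 ∂P ≤ 1 + σf ^ (2 * γ) := fun t ht => by
    obtain ⟨h1, h2⟩ := memLp_two_of_rpow hγ.le (hXm t) (hXγ t ht).1
    exact ⟨h1, h2.trans (by linarith [(hXγ t ht).2])⟩
  have hcov : ∀ s ∈ Finset.Icc 1 (n - h), ∀ t ∈ Finset.Icc 1 (n - h),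
      ∫ ω, (X s ω - ∫ ω', X s ω' ∂P) * (X t ω - ∫ ω', X t ω' ∂P) ∂P
        = ∫ ω, X s ω * X t ω ∂P - (∫ ω, X s ω ∂P) * ∫ ω, X t ω ∂P := fun s hs t ht =>
    covariance_eq_sub (hX2 s hs).1 (hX2 t ht).1
  refine integral_sq_mean_le (by rw [Nat.cast_sub hhn])
    (b := fun d => if d ≤ h then 1 + σf ^ (2 * γ) else
      10 * (σf ^ 2) ^ 2 * alphaCoeff P f (d - h) ^ (1 - 2 / γ))
    (fun t ht => (hX2 t ht).1.sub (memLp_const _)) (fun d => ?_) (fun s hs t ht hst => ?_)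
    (sum_range_decay_le (by positivity) (by positivity) (alphaCoeff_nonneg P f) hmix.1 hmix.2 _ _)
  · have := alphaCoeff_nonneg P f (d - h)
    split_ifs <;> positivity
  · split_ifs with hd
    · have hv : ∀ t ∈ Finset.Icc 1 (n - h),
          ∫ ω, (X t ω - ∫ ω', X t ω' ∂P) ^ 2 ∂P ≤ 1 + σf ^ (2 * γ) := fun t ht => by
        refine le_trans ?_ (hX2 t ht).2
        have := hcov t ht t ht
        simp only [← sq] at this
        rw [this]
        linarith [sq_nonneg (∫ ω, X t ω ∂P)]
      have hm : ∀ t ∈ Finset.Icc 1 (n - h), MemLp (fun ω => X t ω - ∫ ω', X t ω' ∂P) 2 P :=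
        fun t ht => (hX2 t ht).1.sub (memLp_const _)
      have hi := ((hm s hs).integrable_sq.add (hm t ht).integrable_sq).const_mul (1 / 2)
      have := integral_mono ((hm s hs).integrable_mul (hm t ht)) hi fun ω => by
        simp only [Pi.mul_apply, Pi.add_apply]
        nlinarith [sq_nonneg ((X s ω - ∫ ω', X s ω' ∂P) - (X t ω - ∫ ω', X t ω' ∂P))]
      rw [integral_const_mul, integral_add' (hm s hs).integrable_sq (hm t ht).integrable_sq] at this
      refine this.trans ?_
      linarith [hv s hs, hv t ht]
    · refine (hcov s hs t ht).le.trans ((le_abs_self _).trans ?_)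
      have hpow : (σf ^ 2) ^ γ = σf ^ (2 * γ) := by
        rw [← Real.rpow_two, ← Real.rpow_mul hσf.le]
      -- `X s` depends on times up to `s + h` and `X t` on times from `t` on. The natural
      -- subtraction `t - s - h` is exact because the gap exceeds `h`.
      refine abs_cov_le_of_mixing (sigmaField_le hf (Set.Iic ((s : ℤ) + h)))
        (sigmaField_le hf (Set.Ici ((s : ℤ) + h + ((t - s - h : ℕ) : ℤ))))
        (fun A B hA hB => le_alphaCoeff f (t - s - h) ((s : ℤ) + h) hA hB)
        (alphaCoeff_le_one f _) hγ (by positivity) ?_ ?_ (hXγ s hs).1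
        ((hXγ s hs).2.trans hpow.ge) (hXγ t ht).1 ((hXγ t ht).2.trans hpow.ge)
      · refine Measurable.stronglyMeasurable (Measurable.mul ?_ ?_) <;>
          refine measurable_sigmaField f ?_ _ <;> simp
      · refine Measurable.stronglyMeasurable (Measurable.mul ?_ ?_) <;>
          refine measurable_sigmaField f ?_ _ <;> simp only [Set.mem_Ici] <;> omega

/-! ### Products of factors and noise -/

section CondExp

variable {Ω : Type*} {m m₀ : MeasurableSpace Ω} {P : Measure Ω} [IsProbabilityMeasure P]

/-- On the sub-σ-field, the measure with density `Z` is dominated by `c P`; integrating `g` against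
both gives the claim. The Lebesgue integral presupposes no integrability of the product, which is
what has to be shown for squared factors times squared noise. -/
theorem lintegral_mul_le_of_condExp_le
    (hm : m ≤ m₀) {g : Ω → ENNReal} (hg : Measurable[m] g)
    {Z : Ω → ℝ} (hZm : Measurable Z) (hZ : Integrable Z P) (hZ0 : ∀ ω, 0 ≤ Z ω) {c : ℝ}
    (hc : ∀ᵐ ω ∂P, (P[Z | m]) ω ≤ c) :
    ∫⁻ ω, ENNReal.ofReal (Z ω) * g ω ∂P ≤ ENNReal.ofReal c * ∫⁻ ω, g ω ∂P := by
  have hle : (P.withDensity fun ω => ENNReal.ofReal (Z ω)).trim hm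
      ≤ (ENNReal.ofReal c • P).trim hm := by
    refine Measure.le_iff.2 fun A hA => ?_
    rw [trim_measurableSet_eq hm hA, trim_measurableSet_eq hm hA, withDensity_apply _ (hm _ hA),
      Measure.smul_apply, smul_eq_mul,
      ← ofReal_integral_eq_lintegral_ofReal hZ.integrableOn (Eventually.of_forall hZ0),
      ← setIntegral_condExp hm hZ hA]
    have h1 : ∫ ω in A, (P[Z | m]) ω ∂P ≤ ∫ _ in A, c ∂P :=
      integral_mono_ae integrable_condExp.integrableOn (integrable_const _)
        (ae_restrict_of_ae hc)
    rw [setIntegral_const, smul_eq_mul] at h1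
    refine (ENNReal.ofReal_le_ofReal h1).trans ?_
    rw [ENNReal.ofReal_mul measureReal_nonneg, ofReal_measureReal, mul_comm]
  have hg0 : Measurable g := hg.mono hm le_rfl
  have h := lintegral_mono' hle (le_refl g)
  rw [lintegral_trim hm hg, lintegral_trim hm hg,
    lintegral_withDensity_eq_lintegral_mul _ hZm.ennreal_ofReal hg0, lintegral_smul_measure] at h
  exact h

theorem memLp_mul_of_condExp_le
    (hm : m ≤ m₀) {g e : Ω → ℝ} (hg : Measurable[m] g)
    (hgL : MemLp g 2 P) (hem : Measurable e) (heL : MemLp e 2 P) {c : ℝ} (hc0 : 0 ≤ c)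
    (hc : ∀ᵐ ω ∂P, (P[fun ω => e ω * e ω | m]) ω ≤ c) :
    MemLp (fun ω => g ω * e ω) 2 P ∧ ∫ ω, (g ω * e ω) ^ 2 ∂P ≤ c * ∫ ω, g ω ^ 2 ∂P := by
  have hgm : Measurable g := hg.mono hm le_rfl
  have h := lintegral_mul_le_of_condExp_le hm (g := fun ω => ENNReal.ofReal (g ω ^ 2))
    (hg.pow_const 2).ennreal_ofReal (hem.mul hem) (heL.integrable_mul heL)
    (fun ω => mul_self_nonneg _) hc
  have he : ∀ ω, ENNReal.ofReal ((fun ω => e ω * e ω) ω) * ENNReal.ofReal (g ω ^ 2)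
      = ENNReal.ofReal ((g ω * e ω) ^ 2) := fun ω => by
    rw [← ENNReal.ofReal_mul (mul_self_nonneg _)]; congr 1; ring
  have h' : ∫⁻ ω, ENNReal.ofReal ((g ω * e ω) ^ 2) ∂P
      ≤ ENNReal.ofReal (c * ∫ ω, g ω ^ 2 ∂P) := by
    rw [ENNReal.ofReal_mul hc0, ofReal_integral_eq_lintegral_ofReal hgL.integrable_sq
      (Eventually.of_forall fun ω => sq_nonneg _)]
    simpa only [← he, Pi.mul_apply] using h
  have hsq : Integrable (fun ω => (g ω * e ω) ^ 2) P := by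
    refine ⟨((hgm.mul hem).pow_const 2).aestronglyMeasurable, ?_⟩
    rw [hasFiniteIntegral_iff_ofReal (Eventually.of_forall fun ω => sq_nonneg _)]
    exact h'.trans_lt ENNReal.ofReal_lt_top
  refine ⟨(memLp_two_iff_integrable_sq (hgm.mul hem).aestronglyMeasurable).2 hsq, ?_⟩
  have hnn : 0 ≤ c * ∫ ω, g ω ^ 2 ∂P := mul_nonneg hc0 (integral_nonneg fun ω => sq_nonneg _)
  rw [← ofReal_integral_eq_lintegral_ofReal hsq (Eventually.of_forall fun ω => sq_nonneg _)] at h'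
  exact (ENNReal.ofReal_le_ofReal_iff hnn).1 h'

theorem integral_mul_eq_zero_of_condExp
    (hm : m ≤ m₀) {g e : Ω → ℝ} (hg : Measurable[m] g)
    (he : Integrable e P) (hge : Integrable (fun ω => g ω * e ω) P)
    (h0 : P[e | m] =ᵐ[P] 0) : ∫ ω, g ω * e ω ∂P = 0 := by
  rw [← integral_condExp hm (f := fun ω => g ω * e ω)]
  refine (integral_congr_ae ((condExp_mul_of_stronglyMeasurable_left
    hg.stronglyMeasurable hge he).trans ?_)).trans (integral_zero Ω ℝ)
  filter_upwards [h0] with ω hω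
  simp [hω]

end CondExp

section Noise

variable [IsProbabilityMeasure P] {p r n h : ℕ} {f : ℤ → Ω → Fin r → ℝ} {ε : ℤ → Ω → Fin p → ℝ}
  {γ σf σε : ℝ}

theorem CondNoise.integral_eq_zero (hN : CondNoise P f ε n σε) (hf : ∀ t, Measurable (f t))
    {t : ℤ} (ht : t ∈ Set.Icc (1 : ℤ) n) (i : Fin p) : ∫ ω, ε t ω i ∂P = 0 := by
  rw [← integral_condExp (sigmaField_le hf Set.univ), integral_congr_ae (hN.centred t ht i)]
  simp

theorem CondNoise.integral_mul_eq_zero (hN : CondNoise P f ε n σε) (hf : ∀ t, Measurable (f t))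
    {s t : ℤ} (hs : s ∈ Set.Icc (1 : ℤ) n) (ht : t ∈ Set.Icc (1 : ℤ) n) (hst : s ≠ t)
    (i j : Fin p) : ∫ ω, ε s ω i * ε t ω j ∂P = 0 := by
  rw [← integral_condExp (sigmaField_le hf Set.univ),
    integral_congr_ae (hN.uncorr s hs t ht hst i j)]
  simp

theorem CondNoise.integral_sq_le (hN : CondNoise P f ε n σε) (hf : ∀ t, Measurable (f t))
    {t : ℤ} (ht : t ∈ Set.Icc (1 : ℤ) n) (i : Fin p) : ∫ ω, ε t ω i ^ 2 ∂P ≤ σε ^ 2 := by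
  simp only [sq (ε t _ i)]
  rw [← integral_condExp (sigmaField_le hf Set.univ)]
  have := integral_mono_ae (integrable_condExp (μ := P) (m := sigmaField f Set.univ)
    (f := fun ω => ε t ω i * ε t ω i)) (integrable_const (σε ^ 2))
    ((hN.bounded t ht i i).mono fun ω hω => (le_abs_self _).trans hω)
  simpa using this

theorem CondNoise.memLp_mul (hN : CondNoise P f ε n σε) (hf : ∀ t, Measurable (f t))
    (hε : ∀ t, Measurable (ε t)) (hγ : 2 < γ) (hmom : CondMoment P f n γ σf)
    {s t : ℤ} (hs : s ∈ Set.Icc (1 : ℤ) n) (ht : t ∈ Set.Icc (1 : ℤ) n) (i : Fin r) (j : Fin p) :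
    MemLp (fun ω => f s ω i * ε t ω j) 2 P ∧
      ∫ ω, (f s ω i * ε t ω j) ^ 2 ∂P ≤ σε ^ 2 * (1 + σf ^ (2 * γ)) := by
  obtain ⟨h1, h2⟩ := memLp_mul_of_condExp_le (sigmaField_le hf Set.univ)
    (measurable_sigmaField f (Set.mem_univ s) i) (hmom.memLp hγ hf hs i).1
    ((measurable_pi_apply j).comp (hε t)) (hN.memLp t ht j) (sq_nonneg σε)
    ((hN.bounded t ht j j).mono fun ω hω => (le_abs_self _).trans hω)
  exact ⟨h1, h2.trans (mul_le_mul_of_nonneg_left (hmom.memLp hγ hf hs i).2 (sq_nonneg _))⟩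

theorem CondNoise.integral_factor_mul_eq_zero (hN : CondNoise P f ε n σε)
    (hf : ∀ t, Measurable (f t)) (hγ : 2 < γ) (hmom : CondMoment P f n γ σf)
    {s t : ℤ} (hs : s ∈ Set.Icc (1 : ℤ) n) (ht : t ∈ Set.Icc (1 : ℤ) n) (i : Fin r) (j : Fin p) :
    ∫ ω, f s ω i * ε t ω j ∂P = 0 :=
  integral_mul_eq_zero_of_condExp (sigmaField_le hf Set.univ)
    (measurable_sigmaField f (Set.mem_univ s) i) ((hN.memLp t ht j).integrable one_le_two)
    ((hmom.memLp hγ hf hs i).1.integrable_mul (hN.memLp t ht j)) (hN.centred t ht j)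

/-- Both factor entries are measurable for the conditioning σ-field and can be pulled out, leaving
conditionally uncorrelated noise. Only the noise times have to differ. -/
theorem CondNoise.integral_mul_mul_eq_zero (hN : CondNoise P f ε n σε)
    (hf : ∀ t, Measurable (f t)) (hε : ∀ t, Measurable (ε t)) (hγ : 2 < γ)
    (hmom : CondMoment P f n γ σf) {s t s' t' : ℤ} (hs : s ∈ Set.Icc (1 : ℤ) n)
    (ht : t ∈ Set.Icc (1 : ℤ) n) (hs' : s' ∈ Set.Icc (1 : ℤ) n) (ht' : t' ∈ Set.Icc (1 : ℤ) n)
    (hne : t ≠ t') (i : Fin r) (j : Fin p) :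
    ∫ ω, (f s ω i * ε t ω j) * (f s' ω i * ε t' ω j) ∂P = 0 := by
  have e : (fun ω => (f s ω i * ε t ω j) * (f s' ω i * ε t' ω j))
      = fun ω => (f s ω i * f s' ω i) * (ε t ω j * ε t' ω j) := by funext ω; ring
  have hi : Integrable (fun ω => (f s ω i * ε t ω j) * (f s' ω i * ε t' ω j)) P :=
    (hN.memLp_mul hf hε hγ hmom hs ht i j).1.integrable_mul
      (hN.memLp_mul hf hε hγ hmom hs' ht' i j).1
  rw [e] at hi ⊢
  exact integral_mul_eq_zero_of_condExp (sigmaField_le hf Set.univ)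
    ((measurable_sigmaField f (Set.mem_univ s) i).mul
      (measurable_sigmaField f (Set.mem_univ s') i))
    ((hN.memLp t ht j).integrable_mul (hN.memLp t' ht' j)) hi (hN.uncorr t ht t' ht' hne j j)

theorem integral_sq_factor_noise_mean_le (hN : CondNoise P f ε n σε) (hf : ∀ t, Measurable (f t))
    (hε : ∀ t, Measurable (ε t)) (hγ : 2 < γ) (hσf : 0 < σf) (hmom : CondMoment P f n γ σf)
    (hhn : h ≤ n) (i : Fin r) (j : Fin p) :
    Integrable (fun ω => (((n : ℝ) - h)⁻¹ * ∑ t ∈ Finset.Icc 1 (n - h),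
        f (t : ℤ) ω i * ε ((t : ℤ) + h) ω j) ^ 2) P ∧
      ∫ ω, (((n : ℝ) - h)⁻¹ * ∑ t ∈ Finset.Icc 1 (n - h),
        f (t : ℤ) ω i * ε ((t : ℤ) + h) ω j) ^ 2 ∂P
        ≤ 2 * (σε ^ 2 * (1 + σf ^ (2 * γ))) / ((n : ℝ) - h) :=
  integral_sq_mean_le_of_orthogonal (by rw [Nat.cast_sub hhn]) (by positivity)
    (fun _ ht => hN.memLp_mul hf hε hγ hmom (mem_Icc_of_mem ht).1 (mem_Icc_of_mem ht).2 i j)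
    fun _ hs _ ht hst => hN.integral_mul_mul_eq_zero hf hε hγ hmom (mem_Icc_of_mem hs).1
      (mem_Icc_of_mem hs).2 (mem_Icc_of_mem ht).1 (mem_Icc_of_mem ht).2 (by omega) i j

theorem integral_sq_noise_factor_mean_le (hN : CondNoise P f ε n σε) (hf : ∀ t, Measurable (f t))
    (hε : ∀ t, Measurable (ε t)) (hγ : 2 < γ) (hσf : 0 < σf) (hmom : CondMoment P f n γ σf)
    (hhn : h ≤ n) (i : Fin p) (j : Fin r) :
    Integrable (fun ω => (((n : ℝ) - h)⁻¹ * ∑ t ∈ Finset.Icc 1 (n - h),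
        ε (t : ℤ) ω i * f ((t : ℤ) + h) ω j) ^ 2) P ∧
      ∫ ω, (((n : ℝ) - h)⁻¹ * ∑ t ∈ Finset.Icc 1 (n - h),
        ε (t : ℤ) ω i * f ((t : ℤ) + h) ω j) ^ 2 ∂P
        ≤ 2 * (σε ^ 2 * (1 + σf ^ (2 * γ))) / ((n : ℝ) - h) := by
  simp only [mul_comm (ε _ _ i)]
  exact integral_sq_mean_le_of_orthogonal (by rw [Nat.cast_sub hhn]) (by positivity)
    (fun _ ht => hN.memLp_mul hf hε hγ hmom (mem_Icc_of_mem ht).2 (mem_Icc_of_mem ht).1 j i)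
    fun _ hs _ ht hst => hN.integral_mul_mul_eq_zero hf hε hγ hmom (mem_Icc_of_mem hs).2
      (mem_Icc_of_mem hs).1 (mem_Icc_of_mem ht).2 (mem_Icc_of_mem ht).1 (by omega) j i

/-- Independence of the two times splits the squared product, so second moments of the noise
suffice. -/
theorem CondNoise.memLp_mul_self (hN : CondNoise P f ε n σε) (hf : ∀ t, Measurable (f t))
    (hε : ∀ t, Measurable (ε t)) {s t : ℤ} (hs : s ∈ Set.Icc (1 : ℤ) n)
    (ht : t ∈ Set.Icc (1 : ℤ) n) (hst : s ≠ t) (i j : Fin p) :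
    MemLp (fun ω => ε s ω i * ε t ω j) 2 P ∧
      ∫ ω, (ε s ω i * ε t ω j) ^ 2 ∂P ≤ σε ^ 2 * σε ^ 2 := by
  have hms : Measurable fun ω => ε s ω i := (measurable_pi_apply i).comp (hε s)
  have hmt : Measurable fun ω => ε t ω j := (measurable_pi_apply j).comp (hε t)
  have hind : IndepFun (fun ω => ε s ω i ^ 2) (fun ω => ε t ω j ^ 2) P :=
    (hN.indep.indepFun hst).comp (φ := fun v : Fin p → ℝ => v i ^ 2)
      (ψ := fun v : Fin p → ℝ => v j ^ 2) ((measurable_pi_apply i).pow_const 2)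
      ((measurable_pi_apply j).pow_const 2)
  have hi : Integrable (fun ω => (ε s ω i * ε t ω j) ^ 2) P := by
    simp only [mul_pow]
    exact hind.integrable_mul (hN.memLp s hs i).integrable_sq (hN.memLp t ht j).integrable_sq
  refine ⟨(memLp_two_iff_integrable_sq (hms.mul hmt).aestronglyMeasurable).2 hi, ?_⟩
  simp only [mul_pow]
  rw [hind.integral_fun_mul_eq_mul_integral (hms.pow_const 2).aestronglyMeasurable
    (hmt.pow_const 2).aestronglyMeasurable]
  exact mul_le_mul (hN.integral_sq_le hf hs i) (hN.integral_sq_le hf ht j)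
    (integral_nonneg fun ω => sq_nonneg _) (sq_nonneg _)

/-- The noise at time `s` is centred and independent of the other three entries jointly. The times
`t`, `u`, `v` may coincide, as happens when two lagged products overlap. -/
theorem CondNoise.integral_mul_mul_self_eq_zero (hN : CondNoise P f ε n σε)
    (hf : ∀ t, Measurable (f t)) (hε : ∀ t, Measurable (ε t)) {s t u v : ℤ}
    (hs : s ∈ Set.Icc (1 : ℤ) n) (hst : s ≠ t) (hsu : s ≠ u) (hsv : s ≠ v) (i j : Fin p) :
    ∫ ω, (ε s ω i * ε t ω j) * (ε u ω i * ε v ω j) ∂P = 0 := by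
  have hm : ∀ t i, Measurable fun ω => ε t ω i := fun t i => (measurable_pi_apply i).comp (hε t)
  have hdis : Disjoint ({s} : Finset ℤ) {t, u, v} := by
    simp [hst, hsu, hsv]
  have h1 := hN.indep.indepFun_finset {s} {t, u, v} hdis hε
  have h2 : IndepFun (fun ω => ε s ω i) (fun ω => ε t ω j * (ε u ω i * ε v ω j)) P :=
    h1.comp (φ := fun w : (({s} : Finset ℤ) → Fin p → ℝ) => w ⟨s, by simp⟩ i)
      (ψ := fun w : (({t, u, v} : Finset ℤ) → Fin p → ℝ) =>
        w ⟨t, by simp⟩ j * (w ⟨u, by simp⟩ i * w ⟨v, by simp⟩ j))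
      (by fun_prop) (by fun_prop)
  simp only [mul_assoc]
  rw [h2.integral_fun_mul_eq_mul_integral (hm s i).aestronglyMeasurable
    ((hm t j).mul ((hm u i).mul (hm v j))).aestronglyMeasurable, hN.integral_eq_zero hf hs i,
    zero_mul]

theorem integral_sq_noise_mean_le (hN : CondNoise P f ε n σε) (hf : ∀ t, Measurable (f t))
    (hε : ∀ t, Measurable (ε t)) (hh : 1 ≤ h) (hhn : h ≤ n) (i j : Fin p) :
    Integrable (fun ω => (((n : ℝ) - h)⁻¹ * ∑ t ∈ Finset.Icc 1 (n - h),
        ε (t : ℤ) ω i * ε ((t : ℤ) + h) ω j) ^ 2) P ∧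
      ∫ ω, (((n : ℝ) - h)⁻¹ * ∑ t ∈ Finset.Icc 1 (n - h),
        ε (t : ℤ) ω i * ε ((t : ℤ) + h) ω j) ^ 2 ∂P
        ≤ 2 * (σε ^ 2 * σε ^ 2) / ((n : ℝ) - h) :=
  integral_sq_mean_le_of_orthogonal (by rw [Nat.cast_sub hhn]) (by positivity)
    (fun _ ht => hN.memLp_mul_self hf hε (mem_Icc_of_mem ht).1 (mem_Icc_of_mem ht).2
      (by omega) i j)
    fun _ hs _ ht hst => hN.integral_mul_mul_self_eq_zero hf hε (mem_Icc_of_mem hs).1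
      (by omega) (by omega) (by omega) i j

end Noise

end SecondMoments

end FactorModel

namespace FactorModel

open Matrix

/-! ### Frobenius norm, perturbation of subspaces, and the spectral gap of `M`. -/

section Frobenius

open scoped Matrix.Norms.Frobenius

theorem frobenius_norm_sq {a b : ℕ} (A : Matrix (Fin a) (Fin b) ℝ) :
    ‖A‖ ^ 2 = ∑ i, ∑ j, A i j ^ 2 := by
  rw [Matrix.frobenius_norm_def, ← Real.sqrt_eq_rpow, Real.sq_sqrt (by positivity)]
  simp

theorem trace_mul_transpose_self {a b : ℕ} (A : Matrix (Fin a) (Fin b) ℝ) :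
    (A * Aᵀ).trace = ‖A‖ ^ 2 := by
  rw [frobenius_norm_sq]
  simp [Matrix.trace, Matrix.mul_apply, sq]

theorem trace_mul_transpose_le {a b : ℕ} (A B : Matrix (Fin a) (Fin b) ℝ) :
    (A * Bᵀ).trace ≤ ‖A‖ * ‖B‖ := by
  have h := Real.sum_mul_le_sqrt_mul_sqrt Finset.univ
    (fun x : Fin a × Fin b => A x.1 x.2) (fun x => B x.1 x.2)
  simp only [Fintype.sum_prod_type] at h
  rw [← frobenius_norm_sq, ← frobenius_norm_sq, Real.sqrt_sq (norm_nonneg _),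
    Real.sqrt_sq (norm_nonneg _)] at h
  simpa [Matrix.trace, Matrix.mul_apply] using h

theorem norm_mulVec_le {a b : ℕ} (A : Matrix (Fin a) (Fin b) ℝ) (v : EuclideanSpace ℝ (Fin b)) :
    ‖(WithLp.toLp 2 (A *ᵥ v.ofLp) : EuclideanSpace ℝ (Fin a))‖ ≤ ‖A‖ * ‖v‖ := by
  refine le_of_sq_le_sq ?_ (by positivity)
  rw [mul_pow, frobenius_norm_sq, EuclideanSpace.norm_sq_eq, EuclideanSpace.norm_sq_eq,
    Finset.sum_mul]
  refine Finset.sum_le_sum fun i _ => ?_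
  simpa [Matrix.mulVec, dotProduct] using
    Finset.sum_mul_sq_le_sq_mul_sq Finset.univ (fun j => A i j) (fun j => v j)

/-! ### Perturbation of the maximizer of the trace -/

section DavisKahan

variable {p r : ℕ} {S T : Matrix (Fin p) (Fin r) ℝ}

/-- Both projections are idempotent of trace `r`, so the squared distance is affine in the trace of
their product. This ties the Frobenius distance to `traceDist`. -/
theorem norm_proj_sub_sq (hS : Sᵀ * S = 1) (hT : Tᵀ * T = 1) :
    ‖T * Tᵀ - S * Sᵀ‖ ^ 2 = 2 * ((r : ℝ) - (T * Tᵀ * (S * Sᵀ)).trace) := by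
  rw [← trace_mul_transpose_self]
  have e : (T * Tᵀ - S * Sᵀ) * (T * Tᵀ - S * Sᵀ)ᵀ
      = T * (Tᵀ * T) * Tᵀ + S * (Sᵀ * S) * Sᵀ - T * Tᵀ * (S * Sᵀ) - S * Sᵀ * (T * Tᵀ) := by
    simp only [transpose_sub, transpose_mul, transpose_transpose, Matrix.mul_sub, Matrix.sub_mul,
      Matrix.mul_assoc]
    abel
  rw [e, hS, hT, trace_sub, trace_sub, trace_add, Matrix.mul_one, Matrix.mul_one,
    trace_mul_comm T, trace_mul_comm S Sᵀ, hS, hT, trace_mul_comm (S * Sᵀ)]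
  simp; ring

/-- If `M = S N Sᵀ` with `N ≥ λ`, then a maximizer `T` of `tr(Tᵀ M' T)` spans nearly the same space
as `S`. -/
theorem norm_proj_sub_le_of_trace_le {M' : Matrix (Fin p) (Fin p) ℝ} {N : Matrix (Fin r) (Fin r) ℝ}
    {l : ℝ} (hl : 0 < l) (hS : Sᵀ * S = 1) (hT : Tᵀ * T = 1)
    (hN : (N - l • (1 : Matrix (Fin r) (Fin r) ℝ)).PosSemidef)
    (hmax : (Sᵀ * M' * S).trace ≤ (Tᵀ * M' * T).trace) :
    ‖T * Tᵀ - S * Sᵀ‖ ≤ 2 * ‖M' - S * N * Sᵀ‖ / l := by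
  set M := S * N * Sᵀ with hM
  -- `G` is the part of `S` orthogonal to the columns of `T`. Weighting it with `N - l ≥ 0` shows
  -- that the loss in `tr(TᵀMT)` is at least `l` times `r - tr(TTᵀSSᵀ)`.
  set G := S - T * (Tᵀ * S) with hG
  have hGG : Gᵀ * G = 1 - Sᵀ * T * (Tᵀ * S) := by
    have : Gᵀ * G = Sᵀ * S - Sᵀ * T * (Tᵀ * S) - Sᵀ * T * (Tᵀ * S)
        + Sᵀ * T * (Tᵀ * T) * (Tᵀ * S) := by
      simp only [hG, transpose_sub, transpose_mul, transpose_transpose, Matrix.mul_sub,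
        Matrix.sub_mul, Matrix.mul_assoc]
      abel
    rw [this, hS, hT, Matrix.mul_one]; abel
  have hpos : 0 ≤ (G * (N - l • (1 : Matrix (Fin r) (Fin r) ℝ)) * Gᵀ).trace := by
    have := (hN.mul_mul_conjTranspose_same G).trace_nonneg
    simpa using this
  have e1 : (T * Tᵀ * (S * Sᵀ)).trace = (Sᵀ * T * (Tᵀ * S)).trace := by
    rw [← Matrix.mul_assoc, trace_mul_comm]; simp only [Matrix.mul_assoc]
  have e2 : (G * (N - l • (1 : Matrix (Fin r) (Fin r) ℝ)) * Gᵀ).trace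
      = (N.trace - (Tᵀ * M * T).trace) - l * ((r : ℝ) - (T * Tᵀ * (S * Sᵀ)).trace) := by
    rw [Matrix.mul_assoc, trace_mul_comm, Matrix.mul_assoc, hGG, e1]
    rw [Matrix.sub_mul, Matrix.mul_sub, Matrix.mul_one, trace_sub, trace_sub]
    simp only [Matrix.smul_mul, Matrix.one_mul, trace_smul, trace_sub, trace_one, smul_eq_mul,
      Fintype.card_fin]
    have : (N * (Sᵀ * T * (Tᵀ * S))).trace = (Tᵀ * M * T).trace := by
      rw [hM, show N * (Sᵀ * T * (Tᵀ * S)) = (N * Sᵀ * T) * (Tᵀ * S) by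
        simp only [Matrix.mul_assoc], trace_mul_comm]
      simp only [Matrix.mul_assoc]
    rw [this]
  have e3 : (Sᵀ * M * S).trace = N.trace := by
    have : Sᵀ * M * S = (Sᵀ * S) * N * (Sᵀ * S) := by simp only [hM, Matrix.mul_assoc]
    rw [this, hS, Matrix.one_mul, Matrix.mul_one]
  have e4 : ((M' - M) * (T * Tᵀ - S * Sᵀ)ᵀ).trace
      = (Tᵀ * M' * T).trace - (Tᵀ * M * T).trace - (Sᵀ * M' * S).trace + (Sᵀ * M * S).trace := by
    have k : ∀ (X : Matrix (Fin p) (Fin p) ℝ) (U : Matrix (Fin p) (Fin r) ℝ),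
        (X * (U * Uᵀ)).trace = (Uᵀ * X * U).trace := fun X U => by
      rw [← Matrix.mul_assoc, trace_mul_comm, ← Matrix.mul_assoc]
    simp only [transpose_sub, transpose_mul, transpose_transpose, Matrix.mul_sub, Matrix.sub_mul,
      trace_sub, k]
    ring
  have h5 := trace_mul_transpose_le (M' - M) (T * Tᵀ - S * Sᵀ)
  have h6 := norm_proj_sub_sq hS hT
  -- By `hmax` the trace in `e4` is at least the loss `tr N - tr(TᵀMT)`, which is at least `l/2`
  -- times the squared distance; Cauchy–Schwarz bounds it above.
  have h7 : l * ‖T * Tᵀ - S * Sᵀ‖ ^ 2 ≤ 2 * ‖M' - M‖ * ‖T * Tᵀ - S * Sᵀ‖ := by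
    rw [h6]; nlinarith
  rw [le_div_iff₀ hl]
  rcases (norm_nonneg (T * Tᵀ - S * Sᵀ)).eq_or_lt with h0 | h0
  · rw [← h0]; simp
  · nlinarith

end DavisKahan

/-! ### Projections onto column spaces -/

section Projection

variable {p r : ℕ} {S T : Matrix (Fin p) (Fin r) ℝ}

theorem toLp_mulVec_mem_colSpace (Z : Matrix (Fin p) (Fin r) ℝ) (w : Fin r → ℝ) :
    (WithLp.toLp 2 (Z *ᵥ w) : EuclideanSpace ℝ (Fin p)) ∈ colSpace Z := by
  have : (WithLp.toLp 2 (Z *ᵥ w) : EuclideanSpace ℝ (Fin p)) = ∑ j, w j • col Z j := by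
    ext i
    simp [Matrix.mulVec, dotProduct, col, mul_comm]
  rw [this]
  exact Submodule.sum_mem _ fun j _ => Submodule.smul_mem _ _ (Submodule.subset_span ⟨j, rfl⟩)

theorem exists_mulVec_of_mem_colSpace {Z : Matrix (Fin p) (Fin r) ℝ}
    {v : EuclideanSpace ℝ (Fin p)} (hv : v ∈ colSpace Z) :
    ∃ w : Fin r → ℝ, v = WithLp.toLp 2 (Z *ᵥ w) := by
  obtain ⟨w, hw⟩ := (Submodule.mem_span_range_iff_exists_fun ℝ).1 hv
  refine ⟨w, ?_⟩
  rw [← hw]; ext i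
  simp [Matrix.mulVec, dotProduct, col, mul_comm]

theorem starProjection_colSpace_apply (hS : Sᵀ * S = 1) (v : EuclideanSpace ℝ (Fin p)) :
    (colSpace S).starProjection v = WithLp.toLp 2 ((S * Sᵀ) *ᵥ v.ofLp) := by
  refine Submodule.eq_starProjection_of_mem_of_inner_eq_zero ?_ ?_
  · rw [← Matrix.mulVec_mulVec]; exact toLp_mulVec_mem_colSpace S _
  · intro w hw
    obtain ⟨u, rfl⟩ := exists_mulVec_of_mem_colSpace hw
    rw [EuclideanSpace.inner_eq_star_dotProduct]
    simp only [star_trivial, WithLp.ofLp_sub]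
    rw [dotProduct_comm, Matrix.dotProduct_mulVec, ← Matrix.mulVec_transpose, Matrix.mulVec_sub,
      Matrix.mulVec_mulVec, ← Matrix.mul_assoc, hS, Matrix.one_mul, sub_self, zero_dotProduct]

theorem projDist_le (hS : Sᵀ * S = 1) (hT : Tᵀ * T = 1) :
    projDist (colSpace T) (colSpace S) ≤ ‖T * Tᵀ - S * Sᵀ‖ := by
  refine ContinuousLinearMap.opNorm_le_bound _ (norm_nonneg _) fun v => ?_
  have : ((colSpace T).starProjection - (colSpace S).starProjection) v
      = WithLp.toLp 2 ((T * Tᵀ - S * Sᵀ) *ᵥ v.ofLp) := by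
    rw [_root_.sub_apply, starProjection_colSpace_apply hS,
      starProjection_colSpace_apply hT, Matrix.sub_mulVec, WithLp.toLp_sub]
  rw [this]
  exact norm_mulVec_le _ _

theorem trace_starProjection_comp (hS : Sᵀ * S = 1) (hT : Tᵀ * T = 1) :
    LinearMap.trace ℝ (EuclideanSpace ℝ (Fin p))
      (((colSpace T).starProjection ∘L (colSpace S).starProjection).toLinearMap)
      = (T * Tᵀ * (S * Sᵀ)).trace := by
  have : ((colSpace T).starProjection ∘L (colSpace S).starProjection).toLinearMap
      = Matrix.toLpLin 2 2 (T * Tᵀ * (S * Sᵀ)) := by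
    ext v : 1
    simp only [ContinuousLinearMap.coe_coe, ContinuousLinearMap.comp_apply]
    rw [starProjection_colSpace_apply hS, starProjection_colSpace_apply hT,
      Matrix.toLpLin_apply, Matrix.mulVec_mulVec]
  rw [this, Matrix.toLpLin_eq_toLin, Matrix.trace_toLin_eq]

/-- By `norm_proj_sub_sq`, the square of the trace distance is the squared Frobenius distance
divided by `2r`. -/
theorem traceDist_le (hr : 1 ≤ r) (hS : Sᵀ * S = 1) (hT : Tᵀ * T = 1) :
    traceDist r (colSpace T) (colSpace S) ≤ ‖T * Tᵀ - S * Sᵀ‖ := by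
  unfold traceDist
  rw [trace_starProjection_comp hS hT]
  refine Real.sqrt_le_iff.2 ⟨norm_nonneg _, ?_⟩
  have h := norm_proj_sub_sq hS hT
  have hr' : (1 : ℝ) ≤ r := by exact_mod_cast hr
  have h0 : 0 ≤ (r : ℝ) - (T * Tᵀ * (S * Sᵀ)).trace := by
    nlinarith [sq_nonneg ‖T * Tᵀ - S * Sᵀ‖]
  have : 1 - (T * Tᵀ * (S * Sᵀ)).trace / r = ((r : ℝ) - (T * Tᵀ * (S * Sᵀ)).trace) / r := by
    field_simp
  rw [this, h]
  exact (div_le_self h0 hr').trans (by linarith)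

/-! ### The loading matrix -/

variable {As : Matrix (Fin p) (Fin r) ℝ}

/-- Gram–Schmidt preserves spans, and so does rescaling by nonzero numbers; independence keeps the
norms of the orthogonal components nonzero. -/
theorem colSpace_orthLoading (hli : LinearIndependent ℝ (col As)) :
    colSpace (orthLoading As) = colSpace As := by
  have h1 : col (orthLoading As) = InnerProductSpace.gramSchmidt ℝ (col (stdLoading As)) := by
    funext j; ext i; simp [col, orthLoading]
  have h2 : ∀ j, col (stdLoading As) j
      = ‖InnerProductSpace.gramSchmidt ℝ (col As) j‖⁻¹ • col As j := fun j => by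
    ext i; simp [col, stdLoading]
  unfold colSpace
  rw [h1, InnerProductSpace.span_gramSchmidt]
  apply le_antisymm
  · rw [Submodule.span_le]
    rintro _ ⟨j, rfl⟩
    rw [h2]
    exact Submodule.smul_mem _ _ (Submodule.subset_span ⟨j, rfl⟩)
  · rw [Submodule.span_le]
    rintro _ ⟨j, rfl⟩
    have hne : ‖InnerProductSpace.gramSchmidt ℝ (col As) j‖ ≠ 0 :=
      norm_ne_zero_iff.2 (InnerProductSpace.gramSchmidt_ne_zero j hli)
    have : col As j = ‖InnerProductSpace.gramSchmidt ℝ (col As) j‖ • col (stdLoading As) j := by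
      rw [h2, smul_smul, mul_inv_cancel₀ hne, one_smul]
    rw [this]
    exact Submodule.smul_mem _ _ (Submodule.subset_span ⟨j, rfl⟩)

/-- The distances see only column spaces, so any orthonormal basis of the loading space can stand in
for `orthLoading`; the normalized Gram–Schmidt vectors provide one. -/
theorem exists_orthonormal_factor (hli : LinearIndependent ℝ (col As)) :
    ∃ S : Matrix (Fin p) (Fin r) ℝ, Sᵀ * S = 1 ∧ colSpace S = colSpace As ∧ S * Sᵀ * As = As := by
  set S : Matrix (Fin p) (Fin r) ℝ :=
    Matrix.of fun i j => InnerProductSpace.gramSchmidtNormed ℝ (col As) j i with hSdef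
  have hcol : col S = InnerProductSpace.gramSchmidtNormed ℝ (col As) := by
    funext j; ext i; simp [col, hSdef]
  have hS : Sᵀ * S = 1 := by
    ext i j
    have h := orthonormal_iff_ite.1 (InnerProductSpace.gramSchmidtNormed_orthonormal hli) i j
    rw [← hcol, EuclideanSpace.inner_eq_star_dotProduct] at h
    rw [Matrix.one_apply, ← h]
    simp [Matrix.mul_apply, col, dotProduct, mul_comm]
  have hsp : colSpace S = colSpace As := by
    unfold colSpace
    rw [hcol, InnerProductSpace.span_gramSchmidtNormed_range, InnerProductSpace.span_gramSchmidt]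
  refine ⟨S, hS, hsp, ?_⟩
  have h : ∀ j, (S * Sᵀ) *ᵥ (col As j).ofLp = (col As j).ofLp := fun j => by
    have hm : col As j ∈ colSpace S := hsp ▸ Submodule.subset_span ⟨j, rfl⟩
    have := starProjection_colSpace_apply hS (col As j)
    rw [Submodule.starProjection_eq_self_iff.2 hm] at this
    exact (congrArg WithLp.ofLp this).symm
  ext i j
  have := congrFun (h j) i
  simpa [Matrix.mulVec, dotProduct, Matrix.mul_apply, col] using this

/-- A matrix `As * B` with `r` distinct nonzero eigenvalues forces `As` to have full column rank. -/
theorem linearIndependent_col_of_condEigen (hr : 1 ≤ r) {B : Matrix (Fin r) (Fin p) ℝ}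
    (h : CondEigen r (As * B)) : LinearIndependent ℝ (col As) := by
  set E := {μ : ℝ | μ ≠ 0 ∧ Module.End.HasEigenvalue (Matrix.toLin' (As * B)) μ} with hE
  have hcard : E.ncard = r := h
  -- An infinite set has `ncard` zero, which `r ≥ 1` excludes.
  have hfin : E.Finite := Set.finite_of_ncard_ne_zero (by omega)
  have : Fintype E := hfin.fintype
  have hv : ∀ μ : E, ∃ v, Module.End.HasEigenvector (Matrix.toLin' (As * B)) (μ : ℝ) v := fun μ =>
    μ.2.2.exists_hasEigenvector
  choose v hv using hv
  have hlin := Module.End.eigenvectors_linearIndependent' (Matrix.toLin' (As * B))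
    (fun μ : E => (μ : ℝ)) Subtype.val_injective v hv
  have hlin' : LinearIndependent ℝ
      (fun μ : E => (WithLp.toLp 2 (v μ) : EuclideanSpace ℝ (Fin p))) :=
    hlin.map' (WithLp.linearEquiv 2 ℝ (Fin p → ℝ)).symm.toLinearMap (LinearEquiv.ker _)
  have hmem : ∀ μ : E, (WithLp.toLp 2 (v μ) : EuclideanSpace ℝ (Fin p)) ∈ colSpace As := by
    intro μ
    have h1 := (hv μ).apply_eq_smul
    rw [Matrix.toLin'_apply, ← Matrix.mulVec_mulVec] at h1
    -- An eigenvector for a nonzero eigenvalue lies in the range of `As`, which therefore contains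
    -- `r` independent vectors.
    have h2 : v μ = As *ᵥ ((μ : ℝ)⁻¹ • B *ᵥ v μ) := by
      rw [Matrix.mulVec_smul, h1, smul_smul, inv_mul_cancel₀ μ.2.1, one_smul]
    rw [h2]
    exact toLp_mulVec_mem_colSpace As _
  have hlin'' : LinearIndependent ℝ (fun μ : E =>
      (⟨WithLp.toLp 2 (v μ), hmem μ⟩ : colSpace As)) :=
    LinearIndependent.of_comp (colSpace As).subtype hlin'
  have h3 := hlin''.fintype_card_le_finrank
  rw [← Nat.card_coe_set_eq, Nat.card_eq_fintype_card] at hcard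
  rw [linearIndependent_iff_card_eq_finrank_span, Fintype.card_fin]
  refine le_antisymm (hcard.ge.trans h3) ?_
  simpa using finrank_range_le_card (R := ℝ) (col As)

theorem minSing_nonneg (Z : Matrix (Fin p) (Fin r) ℝ) : 0 ≤ minSing Z :=
  Real.sInf_nonneg fun _ hs => hs.1.le

theorem dotProduct_transpose_mul_mulVec (Z : Matrix (Fin p) (Fin r) ℝ) (w : Fin r → ℝ) :
    w ⬝ᵥ ((Zᵀ * Z) *ᵥ w) = (Z *ᵥ w) ⬝ᵥ (Z *ᵥ w) := by
  rw [← Matrix.mulVec_mulVec, Matrix.dotProduct_mulVec, Matrix.vecMul_transpose]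

/-- `minSing` ignores zero singular values, so the bound needs full column rank: then every
eigenvalue of `AsᵀAs` is positive and its root belongs to the set whose infimum is `minSing`. -/
theorem minSing_sq_mul_le (hli : LinearIndependent ℝ (col As)) (w : Fin r → ℝ) :
    minSing As ^ 2 * (w ⬝ᵥ w) ≤ (As *ᵥ w) ⬝ᵥ (As *ᵥ w) := by
  have hinj : ∀ w : Fin r → ℝ, As *ᵥ w = 0 → w = 0 := by
    intro w hw
    refine funext (Fintype.linearIndependent_iff.1 hli w ?_)
    ext i
    simpa [Matrix.mulVec, dotProduct, col, mul_comm] using congrFun hw i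
  set D := Asᵀ * As - minSing As ^ 2 • (1 : Matrix (Fin r) (Fin r) ℝ) with hD
  have hherm : D.IsHermitian := by
    rw [Matrix.IsHermitian, hD, Matrix.conjTranspose_eq_transpose_of_trivial]
    simp
  have hpsd : D.PosSemidef := by
    rw [hherm.posSemidef_iff_eigenvalues_nonneg]
    intro j
    set u := (hherm.eigenvectorBasis j).ofLp with hu
    have hune : u ≠ 0 := fun h0 => by
      have h1 := hherm.eigenvectorBasis.orthonormal.ne_zero j
      exact h1 (by ext i; exact congrFun h0 i)
    have h1 : D *ᵥ u = hherm.eigenvalues j • u := hherm.mulVec_eigenvectorBasis j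
    have h2 : (Asᵀ * As) *ᵥ u = (hherm.eigenvalues j + minSing As ^ 2) • u := by
      have h1' : D *ᵥ u = (Asᵀ * As) *ᵥ u - minSing As ^ 2 • u := by
        rw [hD, Matrix.sub_mulVec, Matrix.smul_mulVec, Matrix.one_mulVec]
      rw [h1', sub_eq_iff_eq_add] at h1
      rw [h1, add_smul]
    have hupos : 0 < u ⬝ᵥ u := by
      have := Matrix.dotProduct_star_self_pos_iff.2 hune
      simpa using this
    have h3 : 0 < hherm.eigenvalues j + minSing As ^ 2 := by
      have h4 := dotProduct_transpose_mul_mulVec As u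
      rw [h2, dotProduct_smul, smul_eq_mul] at h4
      have h5 : 0 < (As *ᵥ u) ⬝ᵥ (As *ᵥ u) := by
        have := Matrix.dotProduct_star_self_pos_iff.2 (mt (hinj u) hune)
        simpa using this
      rw [← h4] at h5
      exact pos_of_mul_pos_left h5 hupos.le
    have h6 : minSing As ≤ √(hherm.eigenvalues j + minSing As ^ 2) := by
      refine csInf_le ⟨0, fun s hs => hs.1.le⟩ ⟨Real.sqrt_pos.2 h3, ?_⟩
      rw [Real.sq_sqrt h3.le]
      exact Module.End.hasEigenvalue_of_hasEigenvector (x := u)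
        ⟨Module.End.mem_eigenspace_iff.2 (by rw [Matrix.toLin'_apply, h2]), hune⟩
    have h7 := pow_le_pow_left₀ (minSing_nonneg As) h6 2
    rw [Real.sq_sqrt h3.le] at h7
    simpa using h7
  have h := hpsd.dotProduct_mulVec_nonneg w
  rw [hD, Matrix.sub_mulVec, Matrix.smul_mulVec, Matrix.one_mulVec, dotProduct_sub,
    dotProduct_smul, star_trivial, dotProduct_transpose_mul_mulVec, smul_eq_mul] at h
  linarith

/-- `‖As‖_min ‖As w‖ ≤ ‖Asᵀ As w‖`, squared. -/
theorem minSing_sq_mul_le_transpose (hli : LinearIndependent ℝ (col As)) (w : Fin r → ℝ) :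
    minSing As ^ 2 * ((As *ᵥ w) ⬝ᵥ (As *ᵥ w))
      ≤ (Asᵀ *ᵥ (As *ᵥ w)) ⬝ᵥ (Asᵀ *ᵥ (As *ᵥ w)) := by
  set q := (As *ᵥ w) ⬝ᵥ (As *ᵥ w) with hq
  set u := Asᵀ *ᵥ (As *ᵥ w) with hu
  -- Cauchy–Schwarz for `q = w ⬝ᵥ u`, together with `minSing² (w ⬝ᵥ w) ≤ q`, gives the claim
  -- multiplied by `q`.
  have hq' : q = w ⬝ᵥ u := by
    rw [hq, ← dotProduct_transpose_mul_mulVec, hu, Matrix.mulVec_mulVec]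
  have h1 := minSing_sq_mul_le hli w
  have h2 : (w ⬝ᵥ u) ^ 2 ≤ (w ⬝ᵥ w) * (u ⬝ᵥ u) := by
    simpa [dotProduct, ← sq] using Finset.sum_mul_sq_le_sq_mul_sq Finset.univ w u
  rw [← hq', ← hq] at *
  have hu0 : 0 ≤ u ⬝ᵥ u := by simpa using dotProduct_star_self_nonneg u
  have hq0 : 0 ≤ q := by simpa [hq] using dotProduct_star_self_nonneg (As *ᵥ w)
  rcases hq0.eq_or_lt with h0 | h0
  · rw [← h0]; simpa using hu0
  · have h3 : minSing As ^ 2 * q * q ≤ (u ⬝ᵥ u) * q := by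
      calc minSing As ^ 2 * q * q = minSing As ^ 2 * q ^ 2 := by ring
        _ ≤ minSing As ^ 2 * ((w ⬝ᵥ w) * (u ⬝ᵥ u)) :=
            mul_le_mul_of_nonneg_left h2 (sq_nonneg _)
        _ = minSing As ^ 2 * (w ⬝ᵥ w) * (u ⬝ᵥ u) := by ring
        _ ≤ q * (u ⬝ᵥ u) := mul_le_mul_of_nonneg_right h1 hu0
        _ = _ := mul_comm _ _
    exact le_of_mul_le_mul_right h3 h0

/-- Lower bound for the nonzero eigenvalues of `∑ₕ (As Fₕ Asᵀ)(As Fₕ Asᵀ)ᵀ`. -/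
theorem exists_factorization_posSemidef (hli : LinearIndependent ℝ (col As)) {ι : Type*}
    (I : Finset ι) (F : ι → Matrix (Fin r) (Fin r) ℝ) {c : ℝ}
    (hF : (∑ h ∈ I, F h * (F h)ᵀ - c • (1 : Matrix (Fin r) (Fin r) ℝ)).PosSemidef) (hc : 0 ≤ c)
    {S : Matrix (Fin p) (Fin r) ℝ} (hS : Sᵀ * S = 1) (hsp : colSpace S = colSpace As)
    (hSAs : S * Sᵀ * As = As) :
    ∃ N : Matrix (Fin r) (Fin r) ℝ,
      ∑ h ∈ I, (As * F h * Asᵀ) * (As * F h * Asᵀ)ᵀ = S * N * Sᵀ ∧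
      (N - (c * (minSing As ^ 2 * minSing As ^ 2)) •
        (1 : Matrix (Fin r) (Fin r) ℝ)).PosSemidef := by
  set X : ι → Matrix (Fin p) (Fin p) ℝ := fun h => As * F h * Asᵀ with hX
  have hSX : ∀ h, S * Sᵀ * X h = X h := fun h => by
    simp only [hX, ← Matrix.mul_assoc]; rw [hSAs]
  refine ⟨∑ h ∈ I, Sᵀ * (X h * (X h)ᵀ) * S, ?_, ?_⟩
  · rw [Matrix.mul_sum, Matrix.sum_mul]
    refine Finset.sum_congr rfl fun h _ => ?_
    have : S * (Sᵀ * (X h * (X h)ᵀ) * S) * Sᵀ = (S * Sᵀ * X h) * (S * Sᵀ * X h)ᵀ := by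
      simp only [transpose_mul, transpose_transpose, Matrix.mul_assoc]
    rw [this, hSX]
  · refine Matrix.PosSemidef.of_dotProduct_mulVec_nonneg ?_ fun v => ?_
    · rw [Matrix.IsHermitian, Matrix.conjTranspose_eq_transpose_of_trivial]
      simp [Matrix.transpose_sum, Matrix.mul_assoc]
    · set y := S *ᵥ v with hy
      set u := Asᵀ *ᵥ y with hu
      have hyy : y ⬝ᵥ y = v ⬝ᵥ v := by
        rw [hy, ← dotProduct_transpose_mul_mulVec, hS, Matrix.one_mulVec]
      have hm : (WithLp.toLp 2 y : EuclideanSpace ℝ (Fin p)) ∈ colSpace As :=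
        hsp ▸ toLp_mulVec_mem_colSpace S v
      obtain ⟨w, hw⟩ := exists_mulVec_of_mem_colSpace hm
      have hyw : y = As *ᵥ w := congrArg WithLp.ofLp hw
      -- One factor `minSing²` comes from `Asᵀ` acting on the column space, where it is bounded
      -- below; the other, in `h3`, from the outer `As`.
      have h1 : minSing As ^ 2 * (v ⬝ᵥ v) ≤ u ⬝ᵥ u := by
        rw [← hyy, hu, hyw]; exact minSing_sq_mul_le_transpose hli w
      have h2 : c * (u ⬝ᵥ u) ≤ ∑ h ∈ I, ((F h)ᵀ *ᵥ u) ⬝ᵥ ((F h)ᵀ *ᵥ u) := by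
        have h := hF.dotProduct_mulVec_nonneg u
        rw [Matrix.sub_mulVec, Matrix.smul_mulVec, Matrix.one_mulVec, dotProduct_sub,
          dotProduct_smul, star_trivial, Matrix.sum_mulVec, dotProduct_sum, smul_eq_mul] at h
        have e : ∀ h, u ⬝ᵥ ((F h * (F h)ᵀ) *ᵥ u) = ((F h)ᵀ *ᵥ u) ⬝ᵥ ((F h)ᵀ *ᵥ u) := fun h => by
          simpa using dotProduct_transpose_mul_mulVec (F h)ᵀ u
        simp only [e] at h
        linarith
      have h3 : ∀ h, minSing As ^ 2 * (((F h)ᵀ *ᵥ u) ⬝ᵥ ((F h)ᵀ *ᵥ u))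
          ≤ v ⬝ᵥ ((Sᵀ * (X h * (X h)ᵀ) * S) *ᵥ v) := fun h => by
        refine (minSing_sq_mul_le hli _).trans (le_of_eq ?_)
        have e : Sᵀ * (X h * (X h)ᵀ) * S = ((X h)ᵀ * S)ᵀ * ((X h)ᵀ * S) := by
          simp only [transpose_mul, transpose_transpose, Matrix.mul_assoc]
        rw [e, dotProduct_transpose_mul_mulVec]
        have e' : ((X h)ᵀ * S) *ᵥ v = As *ᵥ ((F h)ᵀ *ᵥ u) := by
          simp only [hX, hu, hy, transpose_mul, transpose_transpose, Matrix.mulVec_mulVec,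
            Matrix.mul_assoc]
        rw [e']
      rw [Matrix.sub_mulVec, Matrix.smul_mulVec, Matrix.one_mulVec, dotProduct_sub,
        dotProduct_smul, star_trivial, Matrix.sum_mulVec, dotProduct_sum, smul_eq_mul, sub_nonneg]
      have hm0 : 0 ≤ minSing As ^ 2 := sq_nonneg _
      calc c * (minSing As ^ 2 * minSing As ^ 2) * (v ⬝ᵥ v)
          = minSing As ^ 2 * (c * (minSing As ^ 2 * (v ⬝ᵥ v))) := by ring
        _ ≤ minSing As ^ 2 * (c * (u ⬝ᵥ u)) :=
            mul_le_mul_of_nonneg_left (mul_le_mul_of_nonneg_left h1 hc) hm0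
        _ ≤ minSing As ^ 2 * ∑ h ∈ I, ((F h)ᵀ *ᵥ u) ⬝ᵥ ((F h)ᵀ *ᵥ u) :=
            mul_le_mul_of_nonneg_left h2 hm0
        _ ≤ _ := by rw [Finset.mul_sum]; exact Finset.sum_le_sum fun h _ => h3 h

theorem frobenius_sq_le_of_entry_le {C₁ : ℝ} (h : ∀ i j, |As i j| ≤ C₁) :
    ‖As‖ ^ 2 ≤ p * r * C₁ ^ 2 := by
  rw [frobenius_norm_sq]
  calc ∑ i, ∑ j, As i j ^ 2 ≤ ∑ _i : Fin p, ∑ _j : Fin r, C₁ ^ 2 :=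
        Finset.sum_le_sum fun i _ => Finset.sum_le_sum fun j _ => by
          rw [← sq_abs]; exact pow_le_pow_left₀ (abs_nonneg _) (h i j) 2
    _ = _ := by simp; ring

end Projection

end Frobenius

/-! ### Comparison of the Frobenius and spectral norms. -/

section SpecNorm

open scoped Matrix.Norms.L2Operator in
theorem sum_sq_col_le_specNorm {p r : ℕ} (Z : Matrix (Fin p) (Fin r) ℝ) (j : Fin r) :
    ∑ i, Z i j ^ 2 ≤ specNorm Z ^ 2 := by
  have h := Matrix.l2_opNorm_mulVec Z (EuclideanSpace.single j 1)
  simp only [PiLp.norm_single, norm_one, mul_one] at h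
  have h2 := pow_le_pow_left₀ (norm_nonneg _) h 2
  rw [EuclideanSpace.norm_sq_eq] at h2
  simpa [specNorm] using h2

-- Each column is the image of a unit vector. The comparison costs only the fixed factor `r`, so it
-- preserves the order `m^{1-δ}`.
open scoped Matrix.Norms.Frobenius in
theorem frobenius_sq_le_specNorm {p r : ℕ} (Z : Matrix (Fin p) (Fin r) ℝ) :
    ‖Z‖ ^ 2 ≤ r * specNorm Z ^ 2 := by
  rw [frobenius_norm_sq, Finset.sum_comm]
  calc ∑ j, ∑ i, Z i j ^ 2 ≤ ∑ _j : Fin r, specNorm Z ^ 2 :=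
        Finset.sum_le_sum fun j _ => sum_sq_col_le_specNorm Z j
    _ = _ := by simp

end SpecNorm

end FactorModel

namespace FactorModel

open Matrix

open scoped Matrix.Norms.Frobenius

theorem integral_add_four {Ω : Type*} [MeasurableSpace Ω] {P : Measure Ω} {a b c d : Ω → ℝ}
    (ha : Integrable a P) (hb : Integrable b P) (hc : Integrable c P) (hd : Integrable d P) :
    ∫ ω, (a ω + b ω + c ω + d ω) ∂P
      = ∫ ω, a ω ∂P + ∫ ω, b ω ∂P + ∫ ω, c ω ∂P + ∫ ω, d ω ∂P := by
  have hab : Integrable (fun ω => a ω + b ω) P := ha.add hb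
  have habc : Integrable (fun ω => a ω + b ω + c ω) P := hab.add hc
  rw [integral_add habc hd, integral_add hab hc, integral_add ha hb]

/-! ### Decomposition of the autocovariances -/

section Decomposition

variable {Ω : Type*}

/-- `(n-h)⁻¹ ∑_{t=1}^{n-h} y_t z_{t+h}ᵀ`. -/
noncomputable def crossMean {d e : ℕ} (y : ℤ → Ω → Fin d → ℝ) (z : ℤ → Ω → Fin e → ℝ) (n h : ℕ)
    (ω : Ω) : Matrix (Fin d) (Fin e) ℝ :=
  Matrix.of fun i j =>
    ((n : ℝ) - (h : ℝ))⁻¹ * ∑ t ∈ Finset.Icc 1 (n - h), y (t : ℤ) ω i * z ((t : ℤ) + h) ω j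

theorem crossMean_eq_sum {d e : ℕ} (y : ℤ → Ω → Fin d → ℝ) (z : ℤ → Ω → Fin e → ℝ) (n h : ℕ)
    (ω : Ω) : crossMean y z n h ω = ((n : ℝ) - (h : ℝ))⁻¹ • ∑ t ∈ Finset.Icc 1 (n - h),
      vecMulVec (y (t : ℤ) ω) (z ((t : ℤ) + h) ω) := by
  ext i j
  simp [crossMean, Matrix.sum_apply, vecMulVec_apply]

theorem vecMulVec_mulVec_add {p r : ℕ} (A : Matrix (Fin p) (Fin r) ℝ) (f g : Fin r → ℝ)
    (e e' : Fin p → ℝ) :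
    vecMulVec (A *ᵥ f + e) (A *ᵥ g + e') =
      A * vecMulVec f g * Aᵀ + A * vecMulVec f e' + vecMulVec e g * Aᵀ + vecMulVec e e' := by
  rw [add_vecMulVec, vecMulVec_add, vecMulVec_add, Matrix.mul_vecMulVec, Matrix.vecMulVec_mul,
    Matrix.vecMulVec_mul, Matrix.mul_vecMulVec, Matrix.vecMul_transpose]
  abel

variable {p r : ℕ} {As : Matrix (Fin p) (Fin r) ℝ} {f : ℤ → Ω → Fin r → ℝ}
  {x ε : ℤ → Ω → Fin p → ℝ}

theorem sampleAutocov_eq [MeasurableSpace Ω] (hx : ∀ t ω, x t ω = As *ᵥ f t ω + ε t ω) (n h : ℕ)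
    (ω : Ω) :
    sampleAutocov x n h ω = As * sampleAutocov f n h ω * Asᵀ + As * crossMean f ε n h ω
      + crossMean ε f n h ω * Asᵀ + crossMean ε ε n h ω := by
  change crossMean x x n h ω = As * crossMean f f n h ω * Asᵀ + _ + _ + _
  simp only [crossMean_eq_sum, hx, vecMulVec_mulVec_add, Finset.sum_add_distrib, smul_add,
    Matrix.mul_smul, Matrix.smul_mul, Matrix.mul_sum, Matrix.sum_mul]

/-- Since `h ≥ 1`, the noise entries belong to different times and are uncorrelated; those
multiplied by factors vanish by conditional centring. No noise covariance survives. -/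
theorem autocov_eq [MeasurableSpace Ω] {P : Measure Ω} [IsProbabilityMeasure P] {n h : ℕ}
    {γ σf σε : ℝ} (hγ : 2 < γ) (hf : ∀ t, Measurable (f t))
    (hmom : CondMoment P f n γ σf) (hN : CondNoise P f ε n σε)
    (hx : ∀ t ω, x t ω = As *ᵥ f t ω + ε t ω) (hh : 1 ≤ h) :
    autocov P x n h = As * autocov P f n h * Asᵀ := by
  have key : ∀ t ∈ Finset.Icc 1 (n - h), ∀ i j,
      ∫ ω, x (t : ℤ) ω i * x ((t : ℤ) + h) ω j ∂P
        = ∑ b, ∑ a, As i a * (∫ ω, f (t : ℤ) ω a * f ((t : ℤ) + h) ω b ∂P) * As j b := by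
    intro t ht i j
    obtain ⟨h1, h2⟩ := mem_Icc_of_mem ht
    have e : ∀ ω, x (t : ℤ) ω i * x ((t : ℤ) + h) ω j
        = (∑ b, ∑ a, As i a * (f (t : ℤ) ω a * f ((t : ℤ) + h) ω b) * As j b)
          + (∑ a, As i a * (f (t : ℤ) ω a * ε ((t : ℤ) + h) ω j))
          + (∑ b, (f ((t : ℤ) + h) ω b * ε (t : ℤ) ω i) * As j b)
          + ε (t : ℤ) ω i * ε ((t : ℤ) + h) ω j := fun ω => by
      have := congrFun (congrFun (vecMulVec_mulVec_add As (f (t : ℤ) ω) (f ((t : ℤ) + h) ω)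
        (ε (t : ℤ) ω) (ε ((t : ℤ) + h) ω)) i) j
      rw [← hx, ← hx] at this
      simpa [vecMulVec_apply, Matrix.mul_apply, Finset.sum_mul, mul_comm (ε (t : ℤ) ω i) (f _ _ _)]
        using this
    have i1 : ∀ a b, Integrable (fun ω => As i a * (f (t : ℤ) ω a * f ((t : ℤ) + h) ω b) * As j b)
        P := fun a b => (((hmom.memLp hγ hf h1 a).1.integrable_mul
          (hmom.memLp hγ hf h2 b).1).const_mul _).mul_const _
    have i2 : ∀ a, Integrable (fun ω => As i a * (f (t : ℤ) ω a * ε ((t : ℤ) + h) ω j)) P :=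
      fun a => ((hmom.memLp hγ hf h1 a).1.integrable_mul (hN.memLp _ h2 j)).const_mul _
    have i3 : ∀ b, Integrable (fun ω => (f ((t : ℤ) + h) ω b * ε (t : ℤ) ω i) * As j b) P :=
      fun b => ((hmom.memLp hγ hf h2 b).1.integrable_mul (hN.memLp _ h1 i)).mul_const _
    have i4 : Integrable (fun ω => ε (t : ℤ) ω i * ε ((t : ℤ) + h) ω j) P :=
      (hN.memLp _ h1 i).integrable_mul (hN.memLp _ h2 j)
    have I1 := integrable_finsetSum Finset.univ fun b _ =>
      integrable_finsetSum Finset.univ fun a _ => i1 a b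
    have I2 := integrable_finsetSum Finset.univ fun a _ => i2 a
    have I3 := integrable_finsetSum Finset.univ fun b _ => i3 b
    simp only [e]
    rw [integral_add_four I1 I2 I3 i4,
      integral_finsetSum _ fun b _ => integrable_finsetSum Finset.univ fun a _ => i1 a b,
      integral_finsetSum _ fun a _ => i2 a, integral_finsetSum _ fun b _ => i3 b,
      hN.integral_mul_eq_zero hf h1 h2 (by omega) i j]
    simp only [integral_const_mul, integral_mul_const,
      hN.integral_factor_mul_eq_zero hf hγ hmom h1 h2,
      hN.integral_factor_mul_eq_zero hf hγ hmom h2 h1]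
    simp only [mul_zero, zero_mul, Finset.sum_const_zero, add_zero]
    refine Finset.sum_congr rfl fun b _ => ?_
    rw [integral_finsetSum _ fun a _ => i1 a b]
    simp only [integral_const_mul, integral_mul_const]
  ext i j
  simp only [autocov, Matrix.mul_apply, Matrix.of_apply, Matrix.transpose_apply]
  rw [Finset.sum_congr rfl fun t ht => key t ht i j]
  simp only [Finset.mul_sum, Finset.sum_mul]
  rw [Finset.sum_comm]
  refine Finset.sum_congr rfl fun b _ => ?_
  rw [Finset.sum_comm]
  refine Finset.sum_congr rfl fun a _ => Finset.sum_congr rfl fun t _ => ?_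
  ring

theorem norm_autocov_le [MeasurableSpace Ω] {P : Measure Ω} [IsProbabilityMeasure P] {n h : ℕ}
    {γ σf : ℝ} (hγ : 2 < γ) (hσf : 0 < σf) (hf : ∀ t, Measurable (f t))
    (hmom : CondMoment P f n γ σf) (hhn : h ≤ n) :
    ‖autocov P f n h‖ ≤ r * (1 + σf ^ (2 * γ)) := by
  have key : ∀ t ∈ Finset.Icc 1 (n - h), ∀ i j,
      |∫ ω, f (t : ℤ) ω i * f ((t : ℤ) + h) ω j ∂P| ≤ 1 + σf ^ (2 * γ) := by
    intro t ht i j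
    obtain ⟨h1, h2⟩ := mem_Icc_of_mem ht
    obtain ⟨L1, B1⟩ := hmom.memLp hγ hf h1 i
    obtain ⟨L2, B2⟩ := hmom.memLp hγ hf h2 j
    refine abs_integral_le_integral_abs.trans ?_
    refine (integral_mono_of_nonneg (Eventually.of_forall fun ω => abs_nonneg _)
      ((L1.integrable_sq.add L2.integrable_sq).const_mul (1 / 2))
      (Eventually.of_forall fun ω => ?_)).trans ?_
    · simp only [abs_mul, Pi.add_apply]
      nlinarith [sq_nonneg (|f (t : ℤ) ω i| - |f ((t : ℤ) + h) ω j|), sq_abs (f (t : ℤ) ω i),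
        sq_abs (f ((t : ℤ) + h) ω j)]
    · rw [integral_const_mul, integral_add' L1.integrable_sq L2.integrable_sq]
      linarith
  have hκ : 0 ≤ 1 + σf ^ (2 * γ) := by positivity
  have hent : ∀ i j, |autocov P f n h i j| ≤ 1 + σf ^ (2 * γ) := by
    intro i j
    have hN : (n : ℝ) - h = ((n - h : ℕ) : ℝ) := by rw [Nat.cast_sub hhn]
    simp only [autocov, Matrix.of_apply, hN, abs_mul]
    have h1 : |∑ t ∈ Finset.Icc 1 (n - h), ∫ ω, f (t : ℤ) ω i * f ((t : ℤ) + h) ω j ∂P|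
        ≤ ((n - h : ℕ) : ℝ) * (1 + σf ^ (2 * γ)) := by
      refine (Finset.abs_sum_le_sum_abs _ _).trans
        ((Finset.sum_le_sum fun t ht => key t ht i j).trans (by simp [mul_add]))
    rw [abs_of_nonneg (by positivity)]
    refine (mul_le_mul_of_nonneg_left h1 (by positivity)).trans ?_
    rw [← mul_assoc]
    exact mul_le_of_le_one_left hκ inv_mul_le_one
  refine le_of_sq_le_sq ?_ (by positivity)
  refine (frobenius_sq_le_of_entry_le hent).trans (le_of_eq ?_)
  ring

end Decomposition

/-! ### Deviation of the sample autocovariances -/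

section Deviation

variable {Ω : Type*} [MeasurableSpace Ω] {P : Measure Ω}

theorem integral_frobenius_sq_le {a b : ℕ} {Z : Ω → Matrix (Fin a) (Fin b) ℝ} {β : ℝ}
    (hZ : ∀ i j, Integrable (fun ω => Z ω i j ^ 2) P ∧ ∫ ω, Z ω i j ^ 2 ∂P ≤ β) :
    Integrable (fun ω => ‖Z ω‖ ^ 2) P ∧ ∫ ω, ‖Z ω‖ ^ 2 ∂P ≤ a * b * β := by
  simp only [frobenius_norm_sq]
  have hi : ∀ i, Integrable (fun ω => ∑ j, Z ω i j ^ 2) P := fun i =>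
    integrable_finsetSum _ fun j _ => (hZ i j).1
  refine ⟨integrable_finsetSum _ fun i _ => hi i, ?_⟩
  rw [integral_finsetSum _ fun i _ => hi i]
  calc ∑ i, ∫ ω, ∑ j, Z ω i j ^ 2 ∂P = ∑ i, ∑ j, ∫ ω, Z ω i j ^ 2 ∂P :=
        Finset.sum_congr rfl fun i _ => integral_finsetSum _ fun j _ => (hZ i j).1
    _ ≤ ∑ _i : Fin a, ∑ _j : Fin b, β :=
        Finset.sum_le_sum fun i _ => Finset.sum_le_sum fun j _ => (hZ i j).2
    _ = _ := by simp; ring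

/-- Bound for `n` times the second moment of an entry of the sample autocovariances of factors and
noise. -/
noncomputable def entryConst (h₀ : ℕ) (γ K σf σε : ℝ) : ℝ :=
  2 * ((h₀ + 1) * (1 + σf ^ (2 * γ)) + 10 * (σf ^ 2) ^ 2 * K)
    + 2 * (σε ^ 2 * (1 + σf ^ (2 * γ))) + 2 * (σε ^ 2 * σε ^ 2)

/-- Bound for `n p⁻²` times the second moment of the deviation of the sample autocovariances. -/
noncomputable def deviationConst (r h₀ : ℕ) (γ K σf σε C₁ : ℝ) : ℝ :=
  8 * ((r * C₁ ^ 2) ^ 2 * r ^ 2 + 2 * (r * C₁ ^ 2) * r + 1) * entryConst h₀ γ K σf σε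

theorem norm_add_four_sq_le {E : Type*} [SeminormedAddCommGroup E] (a b c d : E) :
    ‖a + b + c + d‖ ^ 2 ≤ 4 * (‖a‖ ^ 2 + ‖b‖ ^ 2 + ‖c‖ ^ 2 + ‖d‖ ^ 2) := by
  have h : ‖a + b + c + d‖ ≤ ‖a‖ + ‖b‖ + ‖c‖ + ‖d‖ :=
    (norm_add_le _ _).trans (add_le_add_left (norm_add₃_le) _)
  have h2 := pow_le_pow_left₀ (norm_nonneg _) h 2
  nlinarith [sq_nonneg (‖a‖ - ‖b‖), sq_nonneg (‖a‖ - ‖c‖), sq_nonneg (‖a‖ - ‖d‖),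
    sq_nonneg (‖b‖ - ‖c‖), sq_nonneg (‖b‖ - ‖d‖), sq_nonneg (‖c‖ - ‖d‖)]

theorem CondMixing.nonneg {r : ℕ} {f : ℤ → Ω → Fin r → ℝ} {γ K : ℝ} (h : CondMixing P f γ K) :
    0 ≤ K :=
  (tsum_nonneg fun _ => Real.rpow_nonneg (alphaCoeff_nonneg P f _) _).trans h.2

theorem entryConst_pos {h₀ : ℕ} {γ K σf σε : ℝ} (hσf : 0 < σf) (hK : 0 ≤ K) :
    0 < entryConst h₀ γ K σf σε := by
  unfold entryConst; positivity

variable [IsProbabilityMeasure P] {p r n h h₀ : ℕ} {As : Matrix (Fin p) (Fin r) ℝ}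
  {f : ℤ → Ω → Fin r → ℝ} {x ε : ℤ → Ω → Fin p → ℝ} {γ K σf σε C₁ : ℝ}

/-- The majorant collects the four terms of the decomposition. Each has mean of order at most
`p²/n`: the factor term through `u²`, the mixed terms through `u p`, the pure noise through its `p²`
entries. -/
theorem exists_integrable_deviation_bound (hγ : 2 < γ) (hσf : 0 < σf)
    (hf : ∀ t, Measurable (f t)) (hε : ∀ t, Measurable (ε t))
    (hmix : CondMixing P f γ K) (hmom : CondMoment P f n γ σf) (hN : CondNoise P f ε n σε)
    (hx : ∀ t ω, x t ω = As *ᵥ f t ω + ε t ω) (hAs : ∀ i j, |As i j| ≤ C₁)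
    (hh : 1 ≤ h) (hh₀ : h ≤ h₀) (hn : 2 * h₀ ≤ n) :
    ∃ W : Ω → ℝ, Integrable W P ∧
      (∀ ω, ‖sampleAutocov x n h ω - autocov P x n h‖ ^ 2 ≤ W ω) ∧
      ∫ ω, W ω ∂P ≤ deviationConst r h₀ γ K σf σε C₁ * p ^ 2 / n := by
  have hK := hmix.nonneg
  have hhn : h ≤ n := by omega
  have hn0 : 0 < n := by omega
  have hE := entryConst_pos (h₀ := h₀) (γ := γ) (σε := σε) hσf hK
  set B := entryConst h₀ γ K σf σε with hB
  -- Replacing `n - h` by `n/2` costs a factor 2; with the 4 from squaring a sum of four terms it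
  -- makes the 8 in `deviationConst`.
  have hnh : (n : ℝ) / 2 ≤ (n : ℝ) - h := by
    have : (2 * h₀ : ℝ) ≤ n := by exact_mod_cast hn
    have : (h : ℝ) ≤ h₀ := by exact_mod_cast hh₀
    linarith
  have hn0' : (0 : ℝ) < n := by exact_mod_cast hn0
  have hstep : ∀ b, b ≤ B → b / ((n : ℝ) - h) ≤ 2 * B / n := fun b hb => by
    calc b / ((n : ℝ) - h) ≤ B / ((n : ℝ) - h) :=
          div_le_div_of_nonneg_right hb (by linarith)
      _ ≤ B / ((n : ℝ) / 2) := div_le_div_of_nonneg_left hE.le (by positivity) hnh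
      _ = _ := by field_simp
  have c1 : 2 * ((h + 1) * (1 + σf ^ (2 * γ)) + 10 * (σf ^ 2) ^ 2 * K) ≤ B := by
    have h1 : ((h : ℝ) + 1) * (1 + σf ^ (2 * γ)) ≤ (h₀ + 1) * (1 + σf ^ (2 * γ)) := by
      have : (h : ℝ) ≤ h₀ := by exact_mod_cast hh₀
      gcongr
    have h2 : 0 ≤ σε ^ 2 * (1 + σf ^ (2 * γ)) := by positivity
    have h3 : 0 ≤ σε ^ 2 * σε ^ 2 := by positivity
    simp only [hB, entryConst]; linarith
  have h0 : 0 ≤ ((h₀ : ℝ) + 1) * (1 + σf ^ (2 * γ)) + 10 * (σf ^ 2) ^ 2 * K := by positivity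
  have c2 : 2 * (σε ^ 2 * (1 + σf ^ (2 * γ))) ≤ B := by
    have h3 : 0 ≤ σε ^ 2 * σε ^ 2 := by positivity
    simp only [hB, entryConst]; linarith
  have c3 : 2 * (σε ^ 2 * σε ^ 2) ≤ B := by
    have h2 : 0 ≤ σε ^ 2 * (1 + σf ^ (2 * γ)) := by positivity
    simp only [hB, entryConst]; linarith
  obtain ⟨iF, bF⟩ := integral_frobenius_sq_le (P := P) (β := 2 * B / n)
    (Z := fun ω => sampleAutocov f n h ω - autocov P f n h) fun i j => by
      have := integral_sq_factor_mean_le hγ hσf hf hmix hmom hhn i j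
      simp only [Finset.sum_sub_distrib, mul_sub] at this
      exact ⟨this.1, this.2.trans (hstep _ c1)⟩
  obtain ⟨iG, bG⟩ := integral_frobenius_sq_le (P := P) (β := 2 * B / n)
    (Z := fun ω => crossMean f ε n h ω) fun i j => by
      have := integral_sq_factor_noise_mean_le hN hf hε hγ hσf hmom hhn i j
      exact ⟨this.1, this.2.trans (hstep _ c2)⟩
  obtain ⟨iH, bH⟩ := integral_frobenius_sq_le (P := P) (β := 2 * B / n)
    (Z := fun ω => crossMean ε f n h ω) fun i j => by
      have := integral_sq_noise_factor_mean_le hN hf hε hγ hσf hmom hhn i j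
      exact ⟨this.1, this.2.trans (hstep _ c2)⟩
  obtain ⟨iE, bE⟩ := integral_frobenius_sq_le (P := P) (β := 2 * B / n)
    (Z := fun ω => crossMean ε ε n h ω) fun i j => by
      have := integral_sq_noise_mean_le hN hf hε hh hhn i j
      exact ⟨this.1, this.2.trans (hstep _ c3)⟩
  set u : ℝ := p * r * C₁ ^ 2 with hu
  have hu0 : 0 ≤ u := by positivity
  have hAu : ‖As‖ ^ 2 ≤ u := frobenius_sq_le_of_entry_le hAs
  refine ⟨fun ω => 4 * (u ^ 2 * ‖sampleAutocov f n h ω - autocov P f n h‖ ^ 2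
    + u * ‖crossMean f ε n h ω‖ ^ 2 + u * ‖crossMean ε f n h ω‖ ^ 2 + ‖crossMean ε ε n h ω‖ ^ 2),
    ((((iF.const_mul _).add (iG.const_mul _)).add (iH.const_mul _)).add iE).const_mul _,
    fun ω => ?_, ?_⟩
  · have e : sampleAutocov x n h ω - autocov P x n h
        = As * (sampleAutocov f n h ω - autocov P f n h) * Asᵀ + As * crossMean f ε n h ω
          + crossMean ε f n h ω * Asᵀ + crossMean ε ε n h ω := by
      rw [sampleAutocov_eq hx, autocov_eq hγ hf hmom hN hx hh, Matrix.mul_sub, Matrix.sub_mul]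
      abel
    rw [e]
    refine (norm_add_four_sq_le _ _ _ _).trans ?_
    have t : ‖Asᵀ‖ = ‖As‖ := Matrix.frobenius_norm_transpose As
    have n1 : ‖As * (sampleAutocov f n h ω - autocov P f n h) * Asᵀ‖ ^ 2
        ≤ u ^ 2 * ‖sampleAutocov f n h ω - autocov P f n h‖ ^ 2 := by
      calc _ ≤ (‖As‖ * ‖sampleAutocov f n h ω - autocov P f n h‖ * ‖As‖) ^ 2 := by
            refine pow_le_pow_left₀ (norm_nonneg _) ?_ 2
            refine (Matrix.frobenius_norm_mul _ _).trans ?_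
            rw [t]
            exact mul_le_mul_of_nonneg_right (Matrix.frobenius_norm_mul _ _) (norm_nonneg _)
        _ = (‖As‖ ^ 2) ^ 2 * ‖sampleAutocov f n h ω - autocov P f n h‖ ^ 2 := by ring
        _ ≤ _ := by gcongr
    have n2 : ‖As * crossMean f ε n h ω‖ ^ 2 ≤ u * ‖crossMean f ε n h ω‖ ^ 2 := by
      refine (pow_le_pow_left₀ (norm_nonneg _) (Matrix.frobenius_norm_mul _ _) 2).trans ?_
      rw [mul_pow]; gcongr
    have n3 : ‖crossMean ε f n h ω * Asᵀ‖ ^ 2 ≤ u * ‖crossMean ε f n h ω‖ ^ 2 := by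
      refine (pow_le_pow_left₀ (norm_nonneg _) (Matrix.frobenius_norm_mul _ _) 2).trans ?_
      rw [mul_pow, t, mul_comm]; gcongr
    linarith
  · rw [integral_const_mul, integral_add_four (iF.const_mul _) (iG.const_mul _) (iH.const_mul _) iE]
    simp only [integral_const_mul]
    calc _ ≤ 4 * (u ^ 2 * (r * r * (2 * B / n)) + u * (r * p * (2 * B / n))
          + u * (p * r * (2 * B / n)) + p * p * (2 * B / n)) := by gcongr
      _ = _ := by
          simp only [deviationConst, ← hB, hu]; field_simp; ring

end Deviation

/-! ### From autocovariances to subspaces -/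

theorem norm_sum_mul_transpose_sub_le {p : ℕ} {ι : Type*} (I : Finset ι)
    (A B : ι → Matrix (Fin p) (Fin p) ℝ) {V τ : ℝ} (hτ : 0 ≤ τ) (hB : ∀ h ∈ I, ‖B h‖ ≤ V)
    (hAB : ∀ h ∈ I, ‖A h - B h‖ ≤ τ) :
    ‖∑ h ∈ I, A h * (A h)ᵀ - ∑ h ∈ I, B h * (B h)ᵀ‖ ≤ I.card * (2 * V * τ + τ ^ 2) := by
  rw [← Finset.sum_sub_distrib]
  refine (norm_sum_le _ _).trans ?_
  rw [← nsmul_eq_mul]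
  refine Finset.sum_le_card_nsmul _ _ _ fun h hh => ?_
  have e : A h * (A h)ᵀ - B h * (B h)ᵀ
      = (A h - B h) * (B h)ᵀ + B h * (A h - B h)ᵀ + (A h - B h) * (A h - B h)ᵀ := by
    simp only [transpose_sub, Matrix.mul_sub, Matrix.sub_mul]; abel
  have h1 := hB h hh
  have h2 := hAB h hh
  rw [e]
  refine norm_add₃_le.trans ?_
  have m1 := Matrix.frobenius_norm_mul (A h - B h) (B h)ᵀ
  have m2 := Matrix.frobenius_norm_mul (B h) (A h - B h)ᵀ
  have m3 := Matrix.frobenius_norm_mul (A h - B h) (A h - B h)ᵀ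
  rw [Matrix.frobenius_norm_transpose] at m1 m2 m3
  have k1 : ‖A h - B h‖ * ‖B h‖ ≤ τ * V := mul_le_mul h2 h1 (norm_nonneg _) hτ
  have k2 : ‖A h - B h‖ * ‖A h - B h‖ ≤ τ * τ := mul_le_mul h2 h2 (norm_nonneg _) hτ
  nlinarith

section Subspace

variable {Ω : Type*} [MeasurableSpace Ω] {P : Measure Ω} [IsProbabilityMeasure P]
  {p r n h₀ : ℕ} {As T : Matrix (Fin p) (Fin r) ℝ}
  {f : ℤ → Ω → Fin r → ℝ} {x ε : ℤ → Ω → Fin p → ℝ} {γ σf σε c : ℝ}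

theorem covM_eq (hγ : 2 < γ) (hf : ∀ t, Measurable (f t))
    (hmom : CondMoment P f n γ σf) (hN : CondNoise P f ε n σε)
    (hx : ∀ t ω, x t ω = As *ᵥ f t ω + ε t ω) :
    covM P x n h₀ = ∑ h ∈ Finset.Icc 1 h₀,
      (As * autocov P f n h * Asᵀ) * (As * autocov P f n h * Asᵀ)ᵀ := by
  refine Finset.sum_congr rfl fun h hh => ?_
  rw [autocov_eq hγ hf hmom hN hx (Finset.mem_Icc.1 hh).1]

theorem linearIndependent_col (hr : 1 ≤ r) (hγ : 2 < γ) (hf : ∀ t, Measurable (f t))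
    (hmom : CondMoment P f n γ σf) (hN : CondNoise P f ε n σε)
    (hx : ∀ t ω, x t ω = As *ᵥ f t ω + ε t ω) (hM : CondEigen r (covM P x n h₀)) :
    LinearIndependent ℝ (col As) := by
  rw [covM_eq hγ hf hmom hN hx] at hM
  simp only [Matrix.mul_assoc As, ← Matrix.mul_sum] at hM
  exact linearIndependent_col_of_condEigen hr hM

/-- Deterministic bound for the distances of the estimated and the true loading space in terms of
the deviation `τ` of the sample autocovariances. -/
theorem dist_le_of_deviation_le (hr : 1 ≤ r) (hγ : 2 < γ) (hσf : 0 < σf) (hc : 0 < c)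
    (hf : ∀ t, Measurable (f t)) (hmom : CondMoment P f n γ σf) (hN : CondNoise P f ε n σε)
    (hx : ∀ t ω, x t ω = As *ᵥ f t ω + ε t ω) (hM : CondEigen r (covM P x n h₀))
    (hF : (covM P f n h₀ - c • (1 : Matrix (Fin r) (Fin r) ℝ)).PosSemidef) (hn : h₀ ≤ n)
    (hmin : 0 < minSing As) {ω : Ω} (hT : IsEigenEstimator (sampleM x n h₀ ω) T) {τ : ℝ}
    (hτ : 0 ≤ τ)
    (hdev : ∀ h ∈ Finset.Icc 1 h₀, ‖sampleAutocov x n h ω - autocov P x n h‖ ≤ τ) :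
    projDist (colSpace T) (colSpace (orthLoading As)) ≤
        2 * (h₀ * (2 * (r * specNorm As ^ 2 * (r * (1 + σf ^ (2 * γ)))) * τ + τ ^ 2))
          / (c * (minSing As ^ 2 * minSing As ^ 2)) ∧
      traceDist r (colSpace T) (colSpace (orthLoading As)) ≤
        2 * (h₀ * (2 * (r * specNorm As ^ 2 * (r * (1 + σf ^ (2 * γ)))) * τ + τ ^ 2))
          / (c * (minSing As ^ 2 * minSing As ^ 2)) := by
  have hli := linearIndependent_col hr hγ hf hmom hN hx hM
  obtain ⟨S, hS, hsp, hSAs⟩ := exists_orthonormal_factor hli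
  obtain ⟨N, hMN, hNpos⟩ := exists_factorization_posSemidef hli (Finset.Icc 1 h₀)
    (fun h => autocov P f n h) hF hc.le hS hsp hSAs
  rw [← covM_eq hγ hf hmom hN hx] at hMN
  have hl : 0 < c * (minSing As ^ 2 * minSing As ^ 2) := by positivity
  have hdk := norm_proj_sub_le_of_trace_le hl hS hT.1 hNpos (hT.2 S hS)
  rw [← hMN] at hdk
  -- Here the spectral norm replaces the entrywise bound of order `p`: this factor must have order
  -- `m^{1-δ}` to cancel against the gap.
  have hV : ∀ h ∈ Finset.Icc 1 h₀,
      ‖autocov P x n h‖ ≤ r * specNorm As ^ 2 * (r * (1 + σf ^ (2 * γ))) := fun h hh => by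
    rw [Finset.mem_Icc] at hh
    rw [autocov_eq hγ hf hmom hN hx hh.1]
    calc _ ≤ ‖As‖ * ‖autocov P f n h‖ * ‖As‖ := by
          refine (Matrix.frobenius_norm_mul _ _).trans ?_
          rw [Matrix.frobenius_norm_transpose]
          exact mul_le_mul_of_nonneg_right (Matrix.frobenius_norm_mul _ _) (norm_nonneg _)
      _ = ‖As‖ ^ 2 * ‖autocov P f n h‖ := by ring
      _ ≤ _ := mul_le_mul (frobenius_sq_le_specNorm As)
          (norm_autocov_le hγ hσf hf hmom (by omega)) (norm_nonneg _) (by positivity)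
  have hMM := norm_sum_mul_transpose_sub_le (Finset.Icc 1 h₀) (fun h => sampleAutocov x n h ω)
    (fun h => autocov P x n h) hτ hV hdev
  rw [Nat.card_Icc, Nat.add_sub_cancel] at hMM
  have hfin : ‖T * Tᵀ - S * Sᵀ‖ ≤
      2 * (h₀ * (2 * (r * specNorm As ^ 2 * (r * (1 + σf ^ (2 * γ)))) * τ + τ ^ 2))
          / (c * (minSing As ^ 2 * minSing As ^ 2)) :=
    hdk.trans (div_le_div_of_nonneg_right (mul_le_mul_of_nonneg_left hMM zero_le_two) hl.le)
  rw [colSpace_orthLoading hli, ← hsp]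
  exact ⟨(projDist_le hS hT.1).trans hfin, (traceDist_le hr hS hT.1).trans hfin⟩

end Subspace

end FactorModel

/-! ### From mean-square bounds to stochastic order. -/

namespace FactorModel

theorem rate_eq (m p n : ℕ) (δ : ℝ) :
    rate m p n δ = p / (√(n : ℝ)) / (m : ℝ) ^ (1 - δ) := by
  unfold rate
  rw [show δ - 1 = -(1 - δ) by ring, Real.rpow_neg (Nat.cast_nonneg _),
    Real.rpow_neg (Nat.cast_nonneg _), ← Real.sqrt_eq_rpow]
  ring

theorem rate_nonneg (m p n : ℕ) (δ : ℝ) : 0 ≤ rate m p n δ := by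
  rw [rate_eq]; positivity

theorem measure_lt_le_of_integral_le {Ω : Type*} [MeasurableSpace Ω] {P : Measure Ω}
    [IsFiniteMeasure P] {W : Ω → ℝ} (hW : Integrable W P) (hW0 : ∀ ω, 0 ≤ W ω) {s η : ℝ}
    (hs : 0 < s) (h : ∫ ω, W ω ∂P ≤ η * s) : P {ω | s < W ω} ≤ ENNReal.ofReal η := by
  have h1 := mul_meas_ge_le_integral_of_nonneg (Eventually.of_forall hW0) hW s
  have h2 : P.real {ω | s ≤ W ω} ≤ η := by
    rw [mul_comm] at h1
    exact le_of_mul_le_mul_right (h1.trans h) hs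
  refine (measure_mono (t := {ω | s ≤ W ω}) fun ω hω => le_of_lt (α := ℝ) hω).trans ?_
  rw [← ofReal_measureReal]
  exact ENNReal.ofReal_le_ofReal h2

/-- A variable dominated by a quadratic function of a deviation of size `p n^{-1/2}` in `L²`, on the
scale `m^{1-δ}`, is of the order of the rate. -/
theorem isBigOp_rate {Ω : ℕ → Type*} [∀ k, MeasurableSpace (Ω k)] (P : ∀ k, Measure (Ω k))
    [∀ k, IsProbabilityMeasure (P k)] {X : ∀ k, Ω k → ℝ} (hX : ∀ k ω, 0 ≤ X k ω) {m p n : ℕ → ℕ}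
    {δ L b₁ b₂ : ℝ} (hL : 0 ≤ L) (hb₁ : 0 ≤ b₁) (hb₂ : 0 ≤ b₂)
    (hp : ∀ᶠ k in atTop, 0 < p k) (hn : ∀ᶠ k in atTop, 0 < n k)
    (hm : ∀ᶠ k in atTop, 0 < (m k : ℝ) ^ (1 - δ))
    (hrate : ∀ᶠ k in atTop, rate (m k) (p k) (n k) δ ≤ 1)
    (hdev : ∀ᶠ k in atTop, ∃ W : Ω k → ℝ, Integrable W (P k) ∧ (∀ ω, 0 ≤ W ω) ∧
      ∫ ω, W ω ∂(P k) ≤ L * p k ^ 2 / n k ∧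
      ∀ ω τ, 0 ≤ τ → W ω ≤ τ ^ 2 →
        X k ω ≤ b₁ * (τ / (m k : ℝ) ^ (1 - δ)) + b₂ * (τ / (m k : ℝ) ^ (1 - δ)) ^ 2) :
    IsBigOp P X (fun k => rate (m k) (p k) (n k) δ) := by
  intro η hη
  -- Since `l² ≥ L/η`, Markov's inequality at level `(l p n^{-1/2})²` leaves probability at most
  -- `η`; the added 1 keeps `l` positive when `L = 0`.
  set l := √(L / η) + 1 with hl
  have hl0 : 0 < l := by positivity
  have hlL : L ≤ η * l ^ 2 := by
    have h1 : L / η ≤ l ^ 2 := by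
      have := Real.sq_sqrt (show 0 ≤ L / η by positivity)
      nlinarith [Real.sqrt_nonneg (L / η)]
    rw [div_le_iff₀ hη] at h1; linarith
  refine ⟨b₁ * l + b₂ * l ^ 2 + 1, by positivity, ?_⟩
  filter_upwards [hp, hn, hm, hrate, hdev] with k hp hn hm hrate ⟨W, hWi, hW0, hWL, hWX⟩
  set q := (m k : ℝ) ^ (1 - δ) with hq
  set ρ := rate (m k) (p k) (n k) δ with hρ
  have hρ0 : 0 ≤ ρ := rate_nonneg _ _ _ _
  have hn' : (0 : ℝ) < n k := by exact_mod_cast hn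
  have hp' : (0 : ℝ) < p k := by exact_mod_cast hp
  set τ := l * (p k / √(n k : ℝ)) with hτ
  have hτ0 : 0 < τ := by positivity
  have hτρ : τ / q = l * ρ := by rw [hρ, rate_eq, hτ, mul_div_assoc]
  have hτ2 : τ ^ 2 = l ^ 2 * (p k ^ 2 / n k) := by
    rw [hτ, mul_pow, div_pow, Real.sq_sqrt hn'.le]
  -- Off the event `τ² < W` the bound on `X` holds, and `ρ ≤ 1` turns `ρ²` into `ρ`. Monotonicity of
  -- the outer measure needs no measurability of `X`.
  refine (measure_mono fun ω hω => ?_).trans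
    (measure_lt_le_of_integral_le hWi hW0 (s := τ ^ 2) (by positivity) (hWL.trans ?_))
  · by_contra hcon
    have hle := hWX ω τ hτ0.le (not_lt.1 hcon)
    rw [hτρ] at hle
    have hω' : (b₁ * l + b₂ * l ^ 2 + 1) * ρ < X k ω := by
      have : (b₁ * l + b₂ * l ^ 2 + 1) * ρ < |X k ω| := hω
      rwa [abs_of_nonneg (hX k ω)] at this
    have h2 : b₂ * l ^ 2 * (ρ * ρ) ≤ b₂ * l ^ 2 * (ρ * 1) := by gcongr
    nlinarith
  · rw [hτ2, ← mul_assoc, mul_div_assoc]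
    exact mul_le_mul_of_nonneg_right hlL (by positivity)

theorem AsympEq.eventually_bounds {a b : ℕ → ℝ} (h : AsympEq a b) (hb : ∀ k, 0 ≤ b k) :
    ∃ c, 0 < c ∧ ∀ᶠ k in atTop, 0 < b k ∧ c * b k ≤ a k ∧ a k ≤ 4 * c * b k := by
  obtain ⟨c, hc, ht⟩ := h
  refine ⟨c / 2, by positivity, ?_⟩
  filter_upwards [ht.eventually (Ioo_mem_nhds (show c / 2 < c by linarith)
    (show c < 2 * c by linarith))] with k hk
  -- If `b k` were zero, the quotient would be zero by convention, outside the interval `(c/2, 2c)`.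
  have hb0 : 0 < b k := by
    refine (hb k).lt_of_ne fun h0 => ?_
    rw [← h0, div_zero] at hk
    linarith [hk.1]
  refine ⟨hb0, ((lt_div_iff₀ hb0).1 hk.1).le, ?_⟩
  have := ((div_lt_iff₀ hb0).1 hk.2).le
  linarith

end FactorModel

/-! ### Assembly of the theorem. -/

open FactorModel

theorem theorem1
    -- fixed constants
    (r h₀ : ℕ) (hr : 1 ≤ r) (hh₀ : 1 ≤ h₀)
    (γ K σf σε δ C₁ c : ℝ) (hγ : 2 < γ) (hσf : 0 < σf) (hσε : 0 < σε)
    (hδ : δ ∈ Set.Icc (0 : ℝ) 1) (hC₁ : 0 < C₁) (hc : 0 < c)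
    -- the asymptotic regime: dimension and sample size tend to infinity
    (p n : ℕ → ℕ) (hp : Filter.Tendsto p Filter.atTop Filter.atTop)
    (hn : Filter.Tendsto n Filter.atTop Filter.atTop)
    -- the model `x_t = A f_t + ε_t = Aˢ f_tˢ + ε_t`
    {Ω : ℕ → Type*} [∀ k, MeasurableSpace (Ω k)] (P : ∀ k, MeasureTheory.Measure (Ω k))
    [∀ k, MeasureTheory.IsProbabilityMeasure (P k)]
    (A As : ∀ k, Matrix (Fin (p k)) (Fin r) ℝ)
    (f fs : ∀ k, ℤ → Ω k → Fin r → ℝ) (x ε : ∀ k, ℤ → Ω k → Fin (p k) → ℝ)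
    (hfs_meas : ∀ k t, Measurable (fs k t)) (hε_meas : ∀ k t, Measurable (ε k t))
    (hx : ∀ k t ω, x k t ω = Matrix.mulVec (A k) (f k t ω) + ε k t ω)
    (hxs : ∀ k t ω, x k t ω = Matrix.mulVec (As k) (fs k t ω) + ε k t ω)
    (hAs : ∀ k, FactorModel.IsSparseLoading (A k) (As k))
    -- mixing, moments, noise, factor strength, eigenvalues
    (hC1 : ∀ k, FactorModel.CondMixing (P k) (fs k) γ K)
    (hC2 : ∀ k, FactorModel.CondMoment (P k) (fs k) (n k) γ σf)
    (hC3 : ∀ k, FactorModel.CondNoise (P k) (fs k) (ε k) (n k) σε)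
    (hC4 : FactorModel.CondStrength p As δ C₁)
    (hC5 : ∀ᶠ k in Filter.atTop,
      FactorModel.CondEigen r (FactorModel.covM (P k) (x k) (n k) h₀))
    -- the lagged factor autocovariances do not degenerate in the limit
    (hC5' : ∀ᶠ k in Filter.atTop,
      (FactorModel.covM (P k) (fs k) (n k) h₀ - c • (1 : Matrix (Fin r) (Fin r) ℝ)).PosSemidef)
    (hrate : Filter.Tendsto (fun k => FactorModel.rate (FactorModel.nnz (As k)) (p k) (n k) δ)
      Filter.atTop (nhds 0))
    -- the estimator
    (Shat : ∀ k, Ω k → Matrix (Fin (p k)) (Fin r) ℝ)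
    (hShat : ∀ᶠ k in Filter.atTop, ∀ ω,
      FactorModel.IsEigenEstimator (FactorModel.sampleM (x k) (n k) h₀ ω) (Shat k ω)) :
    FactorModel.IsBigOp P
        (fun k ω => FactorModel.projDist (FactorModel.colSpace (Shat k ω))
          (FactorModel.colSpace (FactorModel.orthLoading (As k))))
        (fun k => FactorModel.rate (FactorModel.nnz (As k)) (p k) (n k) δ) ∧
      FactorModel.IsBigOp P
        (fun k ω => FactorModel.traceDist r (FactorModel.colSpace (Shat k ω))
          (FactorModel.colSpace (FactorModel.orthLoading (As k))))
        (fun k => FactorModel.rate (FactorModel.nnz (As k)) (p k) (n k) δ) := by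
  have hK : 0 ≤ K := (hC1 0).nonneg
  have hq0 : ∀ k, 0 ≤ (nnz (As k) : ℝ) ^ (1 - δ) := fun k => by positivity
  obtain ⟨a₁, ha₁, hspec⟩ := hC4.specNorm_sq.eventually_bounds hq0
  obtain ⟨a₂, ha₂, hmin⟩ := hC4.minSing_sq.eventually_bounds hq0
  set κ : ℝ := 1 + σf ^ (2 * γ) with hκ
  have hκ0 : 0 < κ := by positivity
  -- With `q = m^{1-δ}`, the bounds `specNorm² ≤ 4 a₁ q` and `minSing² ≥ a₂ q` turn the
  -- deterministic estimate into `b₁ (τ/q) + b₂ (τ/q)²`.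
  set b₁ : ℝ := 4 * h₀ * (r * (4 * a₁) * (r * κ)) / (c * a₂ ^ 2) with hb₁
  set b₂ : ℝ := 2 * h₀ / (c * a₂ ^ 2) with hb₂
  set L : ℝ := h₀ * deviationConst r h₀ γ K σf σε C₁ with hLdef
  have hL : 0 ≤ L := by
    have := entryConst_pos (h₀ := h₀) (γ := γ) (σε := σε) hσf hK
    simp only [hLdef, deviationConst]; positivity
  have hp0 : ∀ᶠ k in atTop, 0 < p k := hp.eventually_gt_atTop 0
  have hn0 : ∀ᶠ k in atTop, 0 < n k := hn.eventually_gt_atTop 0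
  have hm0 : ∀ᶠ k in atTop, 0 < (nnz (As k) : ℝ) ^ (1 - δ) := hmin.mono fun k hk => hk.1
  have hrate1 : ∀ᶠ k in atTop, rate (nnz (As k)) (p k) (n k) δ ≤ 1 :=
    hrate.eventually (ge_mem_nhds zero_lt_one)
  -- One majorant serves both distances: the sum over the `h₀` lags of the individual ones, whence
  -- the factor `h₀` in `L`.
  have main : ∀ᶠ k in atTop, ∃ W : Ω k → ℝ, Integrable W (P k) ∧ (∀ ω, 0 ≤ W ω) ∧
      ∫ ω, W ω ∂(P k) ≤ L * p k ^ 2 / n k ∧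
      ∀ ω τ, 0 ≤ τ → W ω ≤ τ ^ 2 →
        projDist (colSpace (Shat k ω)) (colSpace (orthLoading (As k)))
          ≤ b₁ * (τ / (nnz (As k) : ℝ) ^ (1 - δ)) + b₂ * (τ / (nnz (As k) : ℝ) ^ (1 - δ)) ^ 2 ∧
        traceDist r (colSpace (Shat k ω)) (colSpace (orthLoading (As k)))
          ≤ b₁ * (τ / (nnz (As k) : ℝ) ^ (1 - δ))
            + b₂ * (τ / (nnz (As k) : ℝ) ^ (1 - δ)) ^ 2 := by
    filter_upwards [hspec, hmin, hC5, hC5', hShat, hn.eventually_ge_atTop (2 * h₀)]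
      with k hspec hmin hC5 hC5' hShat hnk
    set q := (nnz (As k) : ℝ) ^ (1 - δ) with hq
    have hq0 : 0 < q := hmin.1
    have hdev : ∀ h : Finset.Icc 1 h₀, _ := fun h =>
      exists_integrable_deviation_bound hγ hσf (hfs_meas k) (hε_meas k) (hC1 k) (hC2 k) (hC3 k)
        (hxs k) (hC4.max_le k) (Finset.mem_Icc.1 h.2).1 (Finset.mem_Icc.1 h.2).2 hnk
    choose W hWi hWd hWL using hdev
    have hW0 : ∀ h ω, 0 ≤ W h ω := fun h ω => (sq_nonneg _).trans (hWd h ω)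
    refine ⟨fun ω => ∑ h, W h ω, integrable_finsetSum _ fun h _ => hWi h,
      fun ω => Finset.sum_nonneg fun h _ => hW0 h ω, ?_, fun ω τ hτ hWτ => ?_⟩
    · rw [integral_finsetSum _ fun h _ => hWi h]
      refine (Finset.sum_le_card_nsmul _ _ _ fun h _ => hWL h).trans (le_of_eq ?_)
      rw [Finset.card_univ, Fintype.card_coe, Nat.card_Icc, Nat.add_sub_cancel, nsmul_eq_mul,
        hLdef]
      ring
    · have hmin0 : 0 < minSing (As k) := by
        refine (minSing_nonneg _).lt_of_ne fun h0 => ?_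
        have h1 := hmin.2.1
        rw [← h0] at h1
        have : 0 < a₂ * q := by positivity
        norm_num at h1
        linarith
      have hd := dist_le_of_deviation_le hr hγ hσf hc (hfs_meas k) (hC2 k) (hC3 k) (hxs k) hC5 hC5'
        (by omega) hmin0 (hShat ω) hτ fun h hh => abs_le_of_sq_le_sq' ((hWd ⟨h, hh⟩ ω).trans
          ((Finset.single_le_sum (fun h _ => hW0 h ω) (Finset.mem_univ (⟨h, hh⟩ :
            Finset.Icc 1 h₀))).trans hWτ)) hτ |>.2
      have hbound : 2 * (h₀ * (2 * (r * specNorm (As k) ^ 2 * (r * κ)) * τ + τ ^ 2))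
          / (c * (minSing (As k) ^ 2 * minSing (As k) ^ 2))
          ≤ b₁ * (τ / q) + b₂ * (τ / q) ^ 2 := by
        have h1 : 2 * (h₀ * (2 * (r * specNorm (As k) ^ 2 * (r * κ)) * τ + τ ^ 2))
            ≤ 2 * (h₀ * (2 * (r * (4 * a₁ * q) * (r * κ)) * τ + τ ^ 2)) := by
          have := hspec.2.2
          gcongr
        have h2 : c * ((a₂ * q) * (a₂ * q)) ≤ c * (minSing (As k) ^ 2 * minSing (As k) ^ 2) := by
          have := hmin.2.1
          gcongr
        refine (div_le_div₀ (by positivity) h1 (by positivity) h2).trans (le_of_eq ?_)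
        rw [hb₁, hb₂]
        field_simp
        ring
      exact ⟨hd.1.trans hbound, hd.2.trans hbound⟩
  have hb₁0 : 0 ≤ b₁ := by positivity
  have hb₂0 : 0 ≤ b₂ := by positivity
  refine ⟨isBigOp_rate P (fun k ω => norm_nonneg _) hL hb₁0 hb₂0 hp0 hn0 hm0 hrate1 ?_,
    isBigOp_rate P (fun k ω => Real.sqrt_nonneg _) hL hb₁0 hb₂0 hp0 hn0 hm0 hrate1 ?_⟩
  · exact main.mono fun k ⟨W, h1, h2, h3, h4⟩ => ⟨W, h1, h2, h3, fun ω τ a b => (h4 ω τ a b).1⟩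
  · exact main.mono fun k ⟨W, h1, h2, h3, h4⟩ => ⟨W, h1, h2, h3, fun ω τ a b => (h4 ω τ a b).2⟩
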